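/- Fix an integer $k \ge 1$. For $j \ge 0$ let $d_j(n)$ be the number of ordered $j$-tuples of positive integers with product $n$, and let $\Omega(m)$ be the number of prime factors of $m$ counted with multiplicity. For $\varepsilon' > 0$ and $X \ge 3$ put $M := X^{2k/\log\log X}$ and $$\tilde d_k(n) := 1_{(X,2X]}(n) \sum_{\substack{m \mid n,\ m \le M\\ \Omega(m) \le (1+\varepsilon')k\log\log X}} d_{k-1}(m).$$ There are a constant $C_k > 0$ and a function $\delta_k$ with $\delta_k(X) \to 0$ as $X \to \infty$, both depending only on $k$, such that the following holds for all $\varepsilon' > 0$ and all real $X \ge 3$. Let $H_1$ be real with $$(\log X)^{(1+2\varepsilon')k\log k} \le H_1 \le X,$$ let $q \ge 1$ be an integer with $$q \le \min\Bigl\{ \frac{H_1}{(\log X)^{(1+2\varepsilon')k\log k}},\ (\log X)^{10000k^{10}} \Bigr\},$$ and let $a$ be an integer with $(a,q)=1$. Then there is a Lebesgue measurable set $\mathcal E \subset [X/2,2X]$ (which may depend on $a,q,H_1,X,k,\varepsilon'$) of measure $$m(\mathcal E) \le C_k \Bigl( X (\log X)^{-10000k^{10}} + X\,\frac{(\log X)^{3(1+\varepsilon')k\log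 k+7}}{(H_1/q)^2} \Bigr)$$ such that for all $x \in [X/2,2X]\setminus\mathcal E$, $$\sum_{\substack{x \le n \le x+H_1\\ n \equiv a\ (\mathrm{mod}\ q)}} \tilde d_k(n) \le C_k\, \frac{H_1}{q}\, (\log X)^{k-1+\delta_k(X)}.$$ -/

import Mathlib

/-- The `j`-fold divisor function `d_j(n)`: the number of ordered `j`-tuples of positive integers
with product `n` (and `0` for `n = 0`). In particular `d_0(n) = 1_{n = 1}`. -/
def divisorCount (j n : ℕ) : ℕ := (Nat.finMulAntidiag j n).card

/-- The truncation level `M = X ^ (2k / log log X)`. -/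
noncomputable def truncLevel (k : ℕ) (X : ℝ) : ℝ :=
  X ^ (2 * (k : ℝ) / Real.log (Real.log X))

open Classical in
/-- The truncated divisor majorant
`d̃_k(n) = 1_{(X,2X]}(n) ∑ d_{k-1}(m)`, the sum being over the divisors `m` of `n` with `m ≤ M` and
`Ω(m) ≤ (1 + ε') k log log X`. It depends on `k`, `ε'` and `X`. -/
noncomputable def dTilde (k : ℕ) (ε' X : ℝ) (n : ℕ) : ℝ :=
  if X < (n : ℝ) ∧ (n : ℝ) ≤ 2 * X then
    ∑ m ∈ n.divisors.filter (fun m : ℕ => (m : ℝ) ≤ truncLevel k X ∧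
        (ArithmeticFunction.cardFactors m : ℝ) ≤ (1 + ε') * k * Real.log (Real.log X)),
      (divisorCount (k - 1) m : ℝ)
  else 0

/-- The sum of `d̃_k(n)` over the integers `n ≡ a (mod q)` with `x ≤ n ≤ x + H`; only meant for
`x, H ≥ 0`, where all these integers are natural numbers. -/
noncomputable def dTildeSum (k : ℕ) (ε' X x H : ℝ) (a : ℤ) (q : ℕ) : ℝ :=
  ∑ n ∈ (Finset.Icc ⌈x⌉₊ ⌊x + H⌋₊).filter (fun n : ℕ => (n : ℤ) ≡ a [ZMOD (q : ℤ)]),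
    dTilde k ε' X n

/-!
Write `ℓ = log X` and `h = H₁ / q`. An integer `n ≡ a (mod q)` is `a + q t`, and its divisors are
coprime to `q`, so the sum over `[x, x + H₁]` is at most a sum of `w (a + q t)` over `⌊h⌋ + 1`
consecutive `t`, where `w z` is the sum of `d_{k-1}(m)` over the admissible divisors `m` of `z`. The
exceptional set consists of the `x` whose first `t` is one of the places where this sum exceeds
`T = h ℓ ^ (k - 1 + η)`, and it suffices to count those places for each fixed `η > 0` and large `X`
(`exists_tendsto_zero_of_eventually` lets `η` tend to `0`; for bounded `X` everything is
exceptional). As `M = X ^ o(1)`, sums over places with boundedly many divisibility conditions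
`m_j ∣ a + q (t + i_j)` are governed by `1 / lcm(m_1, …, m_r)`.

* If `h` exceeds a large power of `ℓ`, Chebyshev's inequality is enough: the variance over
  intervals of length `N` is, up to a negligible term, at most `N` times the sum of
  `d_{k-1}(m) d_{k-1}(m') / lcm(m, m')` (`variance_le`).
* If `k = 1`, then `w ≤ 1` and no place is exceptional.
* If `k ≥ 2` and `h` is at most a power of `ℓ`, either some `w` exceeds `T / 2r`, or the sum of
  `∏ w (a + q (t + i_j))` over `r`-tuples of distinct `i_j` is at least `(T / 2) ^ r`
  (`pow_le_sum_injective`). In the first case the condition on `Ω` gives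
  `d_{k-1}(m) ≤ k ^ Ω(m) ≤ ℓ ^ ((1 + ε') k log k)`, and the third moment of the number of divisors
  produces the term with `h ^ 2` in the denominator (`card_exists_large_le`). In the second case,
  divisors at distinct places share only primes dividing a difference `i_s - i_t`; such primes are
  so few that they cost only a power of `log ℓ`, and otherwise the tuple behaves like `r`
  independent ones (`sum_compatible_le`, `distinct_moment_le`). With `T` larger than the mean by
  `ℓ ^ η`, a large `r` saves any fixed power of `ℓ`.

The sums over `lcm` are grouped by `n = lcm(m_1, …, m_r)` and then bounded through
`d_a d_b ≤ d_{ab}` and `∑ d_K(n) / n ≤ (∑ 1 / n) ^ K` for divisor-closed sets.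
-/

open Finset

/-! ### Algebra of the divisor functions -/

lemma divisorCount_succ (j n : ℕ) :
    divisorCount (j + 1) n = ∑ x ∈ n.divisorsAntidiagonal, divisorCount j x.1 := by
  unfold divisorCount
  rw [← Finset.card_sigma]
  refine Finset.card_nbij' (fun f => ⟨(∏ i, f (Fin.succ i), f 0), fun i => f (Fin.succ i)⟩)
    (fun s => Fin.cons s.1.2 s.2) ?_ ?_ ?_ ?_
  · intro f hf
    simp only [mem_coe, Nat.mem_finMulAntidiag] at hf
    have h := hf.1
    rw [Fin.prod_univ_succ] at h
    simp only [coe_sigma, Set.mem_sigma_iff, mem_coe, Nat.mem_divisorsAntidiagonal,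
      Nat.mem_finMulAntidiag, true_and]
    refine ⟨⟨by rw [mul_comm]; exact h, hf.2⟩, ?_⟩
    rintro h0
    rw [h0, mul_zero] at h
    exact hf.2 h.symm
  · rintro ⟨⟨a, b⟩, f⟩ hs
    simp only [coe_sigma, Set.mem_sigma_iff, mem_coe, Nat.mem_divisorsAntidiagonal,
      Nat.mem_finMulAntidiag] at hs ⊢
    refine ⟨?_, hs.1.2⟩
    rw [Fin.prod_univ_succ]
    simp only [Fin.cons_zero, Fin.cons_succ]
    rw [hs.2.1, mul_comm]
    exact hs.1.1
  · intro f _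
    exact Fin.cons_self_tail f
  · rintro ⟨⟨a, b⟩, f⟩ hs
    simp only [coe_sigma, Set.mem_sigma_iff, mem_coe, Nat.mem_divisorsAntidiagonal,
      Nat.mem_finMulAntidiag] at hs
    simp [hs.2.1]

/-- `d_j` is the `j`-th power of `ζ` for Dirichlet convolution. -/
lemma divisorCount_eq_zeta_pow (j n : ℕ) :
    divisorCount j n = (ArithmeticFunction.zeta ^ j : ArithmeticFunction ℕ) n := by
  induction j generalizing n with
  | zero =>
    rw [pow_zero, ArithmeticFunction.one_apply, divisorCount]
    split_ifs with h
    · rw [h, Nat.finMulAntidiag_one]; simp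
    · rw [Nat.finMulAntidiag_zero_left h]; simp
  | succ j ih =>
    rw [divisorCount_succ, pow_succ, ArithmeticFunction.mul_apply]
    refine Finset.sum_congr rfl fun x hx => ?_
    rw [ih, ArithmeticFunction.zeta_apply_ne, mul_one]
    exact Nat.ne_zero_of_mem_divisorsAntidiagonal hx |>.2

lemma divisorCount_add (a b n : ℕ) :
    divisorCount (a + b) n =
      ∑ x ∈ n.divisorsAntidiagonal, divisorCount a x.1 * divisorCount b x.2 := by
  simp only [divisorCount_eq_zeta_pow, pow_add, ArithmeticFunction.mul_apply]

lemma sum_divisors_divisorCount (j n : ℕ) :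
    ∑ e ∈ n.divisors, divisorCount j e = divisorCount (j + 1) n := by
  rw [divisorCount_succ, Nat.sum_divisorsAntidiagonal (fun d _ => divisorCount j d)]

lemma divisorCount_zero_left (n : ℕ) : divisorCount 0 n = if n = 1 then 1 else 0 := by
  rw [divisorCount_eq_zeta_pow, pow_zero, ArithmeticFunction.one_apply]

lemma divisorCount_one_right (j : ℕ) : divisorCount j 1 = 1 := by
  induction j with
  | zero => simp [divisorCount_zero_left]
  | succ j ih => rw [← sum_divisors_divisorCount]; simp [ih]

/-- The divisor functions are submultiplicative. -/
lemma divisorCount_mul_le (j m n : ℕ) :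
    divisorCount j (m * n) ≤ divisorCount j m * divisorCount j n := by
  induction j generalizing m n with
  | zero =>
    simp only [divisorCount_zero_left]
    split_ifs with h h1 h2 h2 <;> simp_all
  | succ j ih =>
    simp only [← sum_divisors_divisorCount]
    have himg : (m * n).divisors = (m.divisors ×ˢ n.divisors).image fun x => x.1 * x.2 := by
      open Pointwise in rw [Nat.divisors_mul, Finset.mul_def]
    rw [himg, Finset.sum_mul_sum, ← Finset.sum_product']
    refine (Finset.sum_image_le_of_nonneg (fun _ _ => Nat.zero_le _)).trans ?_
    exact Finset.sum_le_sum fun x _ => ih x.1 x.2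

/-- Expand `d_{b+1}` over divisors `e ∣ n` and use `d_a(n) ≤ d_a(e) d_a(n / e)`. -/
lemma divisorCount_mul_divisorCount_le (a b n : ℕ) :
    divisorCount a n * divisorCount b n ≤ divisorCount (a * b) n := by
  induction b generalizing n with
  | zero =>
    simp only [divisorCount_zero_left, mul_zero]
    split_ifs with h
    · rw [h, divisorCount_one_right]
    · simp
  | succ b ih =>
    rw [divisorCount_succ b, mul_add_one, divisorCount_add, Finset.mul_sum]
    refine Finset.sum_le_sum fun x hx => ?_
    have hx' := (Nat.mem_divisorsAntidiagonal.1 hx).1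
    calc divisorCount a n * divisorCount b x.1
        ≤ divisorCount a x.1 * divisorCount a x.2 * divisorCount b x.1 := by
          gcongr; rw [← hx']; exact divisorCount_mul_le a x.1 x.2
      _ = divisorCount a x.1 * divisorCount b x.1 * divisorCount a x.2 := by ring
      _ ≤ _ := by gcongr; exact ih x.1

lemma divisorCount_pow_le (a r n : ℕ) (hn : n ≠ 0) :
    divisorCount a n ^ r ≤ divisorCount (a ^ r) n := by
  induction r with
  | zero =>
    rw [pow_zero, pow_zero, ← zero_add 1, ← sum_divisors_divisorCount]
    calc 1 = divisorCount 0 1 := (divisorCount_one_right 0).symm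
      _ ≤ _ := Finset.single_le_sum (f := fun e => divisorCount 0 e) (fun _ _ => Nat.zero_le _)
        (Nat.one_mem_divisors.2 hn)
  | succ r ih =>
    rw [pow_succ, pow_succ]
    exact (Nat.mul_le_mul_right _ ih).trans (divisorCount_mul_divisorCount_le _ _ _)

lemma divisorCount_prime (j : ℕ) {p : ℕ} (hp : p.Prime) : divisorCount j p = j := by
  induction j with
  | zero => simp [divisorCount_zero_left, hp.ne_one]
  | succ j ih =>
    rw [← sum_divisors_divisorCount, Nat.Prime.sum_divisors hp, ih, divisorCount_one_right]

lemma divisorCount_le_pow_cardFactors (j n : ℕ) (hn : n ≠ 0) :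
    divisorCount j n ≤ j ^ ArithmeticFunction.cardFactors n := by
  induction n using Nat.recOnMul with
  | zero => exact absurd rfl hn
  | one => simp [divisorCount_one_right]
  | prime p hp => simp [divisorCount_prime j hp, ArithmeticFunction.cardFactors_apply_prime hp]
  | mul a b ha hb =>
    obtain ⟨ha0, hb0⟩ := mul_ne_zero_iff.1 hn
    rw [ArithmeticFunction.cardFactors_mul ha0 hb0, pow_add]
    exact (divisorCount_mul_le j a b).trans (Nat.mul_le_mul (ha ha0) (hb hb0))

/-- For a divisor-closed set `S`, the sum of `d_K(n) / n` over `S` is at most the `K`-th power of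
the sum of `1 / n`: every factor of an element of `S` lies in `S`. -/
lemma sum_divisorCount_div_le (S : Finset ℕ) (hS : ∀ n ∈ S, ∀ d, d ∣ n → d ∈ S)
    (K : ℕ) : ∑ n ∈ S, (divisorCount K n : ℝ) / n ≤ (∑ n ∈ S, (1 : ℝ) / n) ^ K := by
  induction K with
  | zero =>
    rw [pow_zero]
    calc ∑ n ∈ S, (divisorCount 0 n : ℝ) / n ≤ ∑ n ∈ S, if n = 1 then (1 : ℝ) else 0 := by
          refine Finset.sum_le_sum fun n _ => ?_
          rw [divisorCount_zero_left]
          split_ifs with h <;> simp [h]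
      _ ≤ 1 := by
          rw [Finset.sum_ite_eq']
          split_ifs <;> norm_num
  | succ K ih =>
    rw [pow_succ]
    calc ∑ n ∈ S, (divisorCount (K + 1) n : ℝ) / n
        = ∑ s ∈ S.sigma fun n => n.divisorsAntidiagonal,
            (divisorCount K s.2.1 : ℝ) / s.2.1 * (1 / s.2.2) := by
          rw [Finset.sum_sigma]
          refine Finset.sum_congr rfl fun n hn => ?_
          rw [divisorCount_succ, Nat.cast_sum, Finset.sum_div]
          refine Finset.sum_congr rfl fun x hx => ?_
          rw [← (Nat.mem_divisorsAntidiagonal.1 hx).1, Nat.cast_mul]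
          rw [div_mul_div_comm, mul_one]
      _ = ∑ x ∈ (S.sigma fun n => n.divisorsAntidiagonal).image Sigma.snd,
            (divisorCount K x.1 : ℝ) / x.1 * (1 / x.2) := by
          rw [Finset.sum_image]
          rintro ⟨n, x⟩ hx ⟨n', x'⟩ hx' h
          simp only [coe_sigma, Set.mem_sigma_iff, mem_coe, Nat.mem_divisorsAntidiagonal] at *
          subst h
          have : n = n' := by rw [← hx.2.1, ← hx'.2.1]
          subst this
          rfl
      _ ≤ ∑ x ∈ S ×ˢ S, (divisorCount K x.1 : ℝ) / x.1 * (1 / x.2) := by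
          refine Finset.sum_le_sum_of_subset_of_nonneg ?_ fun _ _ _ => by positivity
          intro x hx
          obtain ⟨⟨n, y⟩, hy, rfl⟩ := Finset.mem_image.1 hx
          simp only [mem_sigma, Nat.mem_divisorsAntidiagonal] at hy
          rw [Finset.mem_product]
          exact ⟨hS n hy.1 _ ⟨_, hy.2.1.symm⟩, hS n hy.1 _ ⟨_, by rw [mul_comm]; exact hy.2.1.symm⟩⟩
      _ = (∑ n ∈ S, (divisorCount K n : ℝ) / n) * ∑ n ∈ S, (1 : ℝ) / n := by
          rw [Finset.sum_mul_sum, ← Finset.sum_product']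
      _ ≤ _ := by gcongr

/-! ### Sums over tuples with a least common multiple in the denominator -/

/-- Grouping the tuples by their least common multiple `n`: all entries divide `n`. -/
lemma sum_prod_div_lcm_le {r : ℕ} (S T : Finset ℕ) (g : ℕ → ℝ) (hg : ∀ n, 0 ≤ g n)
    (h0 : 0 ∉ T) (hT : ∀ m ∈ Fintype.piFinset fun _ : Fin r => S, univ.lcm m ∈ T) :
    ∑ m ∈ Fintype.piFinset fun _ : Fin r => S, (∏ j, g (m j)) / (univ.lcm m : ℕ) ≤
      ∑ n ∈ T, (∑ a ∈ n.divisors, g a) ^ r / (n : ℝ) := by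
  rw [← Finset.sum_fiberwise_of_maps_to hT]
  refine Finset.sum_le_sum fun n hn => ?_
  have hn0 : n ≠ 0 := fun h => h0 (h ▸ hn)
  calc ∑ m ∈ (Fintype.piFinset fun _ : Fin r => S) with univ.lcm m = n,
        (∏ j, g (m j)) / (univ.lcm m : ℕ)
      = (∑ m ∈ (Fintype.piFinset fun _ : Fin r => S) with univ.lcm m = n,
          ∏ j, g (m j)) / (n : ℝ) := by
        rw [Finset.sum_div]
        refine Finset.sum_congr rfl fun m hm => ?_
        rw [(Finset.mem_filter.1 hm).2]
    _ ≤ (∑ m ∈ Fintype.piFinset fun _ : Fin r => n.divisors, ∏ j, g (m j)) / (n : ℝ) := by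
        refine div_le_div_of_nonneg_right (Finset.sum_le_sum_of_subset_of_nonneg ?_ fun m _ _ =>
          Finset.prod_nonneg fun j _ => hg _) (Nat.cast_nonneg _)
        intro m hm
        rw [Fintype.mem_piFinset]
        intro j
        rw [Nat.mem_divisors, ← (Finset.mem_filter.1 hm).2]
        exact ⟨Finset.dvd_lcm (Finset.mem_univ j), by rwa [(Finset.mem_filter.1 hm).2]⟩
    _ = _ := by
        rw [← Finset.prod_univ_sum]
        simp

lemma lcm_tuple_mem_Icc {r M : ℕ} {m : Fin r → ℕ}
    (hm : m ∈ Fintype.piFinset fun _ : Fin r => Icc 1 M) : univ.lcm m ∈ Icc 1 (M ^ r) := by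
  rw [Fintype.mem_piFinset] at hm
  have hd : univ.lcm m ∣ ∏ j, m j :=
    Finset.lcm_dvd fun j _ => Finset.dvd_prod_of_mem m (Finset.mem_univ j)
  have hp : 0 < ∏ j, m j := Finset.prod_pos fun j _ => (Finset.mem_Icc.1 (hm j)).1
  rw [Finset.mem_Icc]
  refine ⟨Nat.pos_of_dvd_of_pos hd hp, (Nat.le_of_dvd hp hd).trans ?_⟩
  calc ∏ j, m j ≤ ∏ _j : Fin r, M := Finset.prod_le_prod' fun j _ => (Finset.mem_Icc.1 (hm j)).2
    _ = M ^ r := by simp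

/-- Distinct primes satisfy `p_j ≥ j + 1`, so this product telescopes. -/
lemma prod_primes_geometric_le (P : Finset ℕ) (hP : ∀ p ∈ P, p.Prime) :
    ∏ p ∈ P, (1 - (p : ℝ)⁻¹)⁻¹ ≤ (#P : ℝ) + 1 := by
  induction P using Finset.induction_on_max with
  | empty => simp
  | insert p P hlt ih =>
    have hp : p ∉ P := fun h => (hlt p h).false
    rw [Finset.prod_insert hp, Finset.card_insert_of_notMem hp]
    have h1 := ih fun x hx => hP x (Finset.mem_insert_of_mem hx)
    have hpp := hP p (Finset.mem_insert_self _ _)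
    have hcard : #P + 2 ≤ p := by
      have : P ⊆ Ico 2 p := fun x hx => Finset.mem_Ico.2
        ⟨(hP x (Finset.mem_insert_of_mem hx)).two_le, hlt x hx⟩
      have := Finset.card_le_card this
      rw [Nat.card_Ico] at this
      have := hpp.two_le
      omega
    have hc : (#P : ℝ) + 2 ≤ p := by exact_mod_cast hcard
    have hc0 : (0 : ℝ) ≤ #P := Nat.cast_nonneg _
    have h2 : (1 - (p : ℝ)⁻¹)⁻¹ ≤ ((#P : ℝ) + 2) / (#P + 1) := by
      rw [inv_le_comm₀ _ (by positivity), inv_div, div_le_iff₀ (by positivity)]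
      · have : (p : ℝ)⁻¹ * (#P + 2) ≤ 1 := by
          rw [inv_mul_le_iff₀ (by linarith)]; linarith
        nlinarith
      · rw [sub_pos]; exact inv_lt_one_of_one_lt₀ (by linarith)
    calc (1 - (p : ℝ)⁻¹)⁻¹ * ∏ x ∈ P, (1 - (x : ℝ)⁻¹)⁻¹
        ≤ ((#P : ℝ) + 2) / (#P + 1) * ((#P : ℝ) + 1) := by
          gcongr
          exact Finset.prod_nonneg fun x hx => inv_nonneg.2 (sub_nonneg.2
            (Nat.cast_inv_le_one _))
      _ = _ := by
        rw [div_mul_cancel₀ _ (by positivity)]; push_cast; ring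

lemma sum_factoredNumbers_inv_le (P : Finset ℕ) (hP : ∀ p ∈ P, p.Prime) (S : Finset ℕ)
    (hS : ∀ n ∈ S, n ∈ Nat.factoredNumbers P) : ∑ n ∈ S, (1 : ℝ) / n ≤ (#P : ℝ) + 1 := by
  refine le_trans ?_ (prod_primes_geometric_le P hP)
  let f : ℕ →* ℝ := ⟨⟨fun n => (n : ℝ)⁻¹, by simp⟩, fun a b => by push_cast; rw [mul_inv]⟩
  have hf : ∀ {p : ℕ}, p.Prime → ‖f p‖ < 1 := by
    intro p hp
    have : (1 : ℝ) < p := by exact_mod_cast hp.one_lt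
    change ‖(p : ℝ)⁻¹‖ < 1
    rw [norm_inv, Real.norm_natCast]
    exact inv_lt_one_of_one_lt₀ this
  obtain ⟨h1, h2⟩ :=
    EulerProduct.summable_and_hasSum_factoredNumbers_prod_filter_prime_geometric hf P
  rw [Finset.filter_true_of_mem hP] at h2
  have h3 : ∏ p ∈ P, (1 - f p)⁻¹ = ∏ p ∈ P, (1 - (p : ℝ)⁻¹)⁻¹ := rfl
  rw [← h3]
  classical
  calc ∑ n ∈ S, (1 : ℝ) / n = ∑ n : S, f n := by
        rw [← Finset.sum_coe_sort]; exact Finset.sum_congr rfl fun n _ => one_div _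
    _ = ∑ m ∈ univ.image fun n : S => (⟨n, hS n n.2⟩ : Nat.factoredNumbers P), f m := by
        rw [Finset.sum_image]
        intro a _ b _ h
        exact Subtype.ext (congrArg (fun x : Nat.factoredNumbers P => (x : ℕ)) h)
    _ ≤ _ := sum_le_hasSum _ (fun m _ => inv_nonneg.2 (Nat.cast_nonneg _)) h2

/-- The decomposition of `m` into a part composed of primes dividing `D` and a part coprime to
`D`. -/
lemma exists_factored_mul_coprime (D : ℕ) {m : ℕ} (hm : m ≠ 0) :
    ∃ a b, m = a * b ∧ a ∈ Nat.factoredNumbers D.primeFactors ∧ (D ≠ 0 → b.Coprime D) := by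
  induction m using Nat.recOnMul with
  | zero => exact absurd rfl hm
  | one => exact ⟨1, 1, rfl, by simp [Nat.mem_factoredNumbers], fun _ => by simp⟩
  | prime p hp =>
    by_cases h : p ∈ D.primeFactors
    · refine ⟨p, 1, by simp, ?_, by simp⟩
      rw [Nat.mem_factoredNumbers_iff_primeFactors_subset, hp.primeFactors]
      exact ⟨hp.ne_zero, by simpa using h⟩
    · refine ⟨1, p, by simp, by simp [Nat.mem_factoredNumbers], fun hD => ?_⟩
      rw [hp.coprime_iff_not_dvd]
      exact fun hd => h (Nat.mem_primeFactors.2 ⟨hp, hd, hD⟩)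
  | mul x y hx hy =>
    obtain ⟨hx0, hy0⟩ := mul_ne_zero_iff.1 hm
    obtain ⟨a, b, rfl, ha, hb⟩ := hx hx0
    obtain ⟨c, d, rfl, hc, hd⟩ := hy hy0
    exact ⟨a * c, b * d, by ring, Nat.mul_mem_factoredNumbers ha hc,
      fun hD => (hb hD).mul_left (hd hD)⟩

/-- If the common divisors of the entries `a_j b_j` divide `D`, the parts `b_j` coprime to `D` are
pairwise coprime, and so enter the least common multiple with their full product. -/
lemma one_div_lcm_le_of_factored {r D : ℕ} {a b : Fin r → ℕ}
    (ha : ∀ j, a j ∈ Nat.factoredNumbers D.primeFactors) (hb : ∀ j, (b j).Coprime D)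
    (hb0 : ∀ j, b j ≠ 0) (hc : ∀ s t, s ≠ t → Nat.gcd (a s * b s) (a t * b t) ∣ D) :
    (1 : ℝ) / (univ.lcm fun j => a j * b j : ℕ) ≤ 1 / ((univ.lcm a : ℕ) * ∏ j, (b j : ℝ)) := by
  have h1 : univ.lcm a ∣ univ.lcm fun j => a j * b j :=
    Finset.lcm_dvd fun j _ => (dvd_mul_right _ _).trans
      (Finset.dvd_lcm (f := fun j => a j * b j) (Finset.mem_univ j))
  have h2 : ∏ j, b j ∣ univ.lcm fun j => a j * b j := by
    rw [← Finset.lcm_eq_prod]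
    · exact Finset.lcm_dvd fun j _ => (dvd_mul_left _ _).trans
        (Finset.dvd_lcm (f := fun j => a j * b j) (Finset.mem_univ j))
    · intro s _ t _ hst
      have hg : Nat.gcd (b s) (b t) ∣ D :=
        (Nat.gcd_dvd_gcd_mul_left_left (b s) (b t) (a s) |>.trans
          (Nat.gcd_dvd_gcd_mul_left_right _ _ _)).trans (hc s t hst)
      exact Nat.eq_one_of_dvd_coprimes (hb s) (Nat.gcd_dvd_left _ _) hg
  have hcop : (univ.lcm a).Coprime (∏ j, b j) := by
    refine Nat.Coprime.prod_right fun j _ => ?_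
    refine Nat.Coprime.coprime_dvd_left (Finset.lcm_dvd_prod _ _) ?_
    refine Nat.Coprime.prod_left fun i _ => ?_
    refine Nat.coprime_of_dvd fun p hp hpa hpb => ?_
    have hpD : p ∈ D.primeFactors :=
      (Nat.mem_factoredNumbers.1 (ha i)).2 p
        ((Nat.mem_primeFactorsList (Nat.mem_factoredNumbers.1 (ha i)).1).2 ⟨hp, hpa⟩)
    exact hp.one_lt.ne' (Nat.eq_one_of_dvd_coprimes (hb j) hpb (Nat.dvd_of_mem_primeFactors hpD))
  have h3 := hcop.mul_dvd_of_dvd_of_dvd h1 h2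
  have h4 : univ.lcm (fun j => a j * b j) ≠ 0 := by
    rw [Ne, Finset.lcm_eq_zero_iff]
    rintro ⟨j, -, hj⟩
    exact mul_ne_zero (Nat.mem_factoredNumbers.1 (ha j)).1 (hb0 j) hj
  have h5 := Nat.le_of_dvd (Nat.pos_of_ne_zero h4) h3
  have h6 : 0 < univ.lcm a * ∏ j, b j := Nat.pos_of_ne_zero fun h => h4 (by
    rw [h] at h3; exact zero_dvd_iff.1 h3)
  apply one_div_le_one_div_of_le
  · exact_mod_cast h6
  · exact_mod_cast h5

/-- Tuples whose pairwise greatest common divisors divide `D` behave like independent ones, up to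
the contribution of the primes dividing `D`: once that part is split off, the entries are pairwise
coprime. -/
lemma sum_compatible_le {r D : ℕ} (hD : D ≠ 0) (k M : ℕ) :
    ∑ m ∈ (Fintype.piFinset fun _ : Fin r => Icc 1 M) with
        (∀ s t, s ≠ t → Nat.gcd (m s) (m t) ∣ D),
      (∏ j, (divisorCount k (m j) : ℝ)) / (univ.lcm m : ℕ) ≤
    (∑ b ∈ Icc 1 M, (divisorCount k b : ℝ) / b) ^ r *
      ((#D.primeFactors : ℝ) + 1) ^ ((k + 1) ^ r) := by
  choose! a b hab ha hb using fun m (hm : m ≠ 0) => exists_factored_mul_coprime D hm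
  set S := Icc 1 M with hS
  set S' := S.filter fun n => n.primeFactors ⊆ D.primeFactors with hS'
  set T := (Icc 1 (M ^ r)).filter fun n => n.primeFactors ⊆ D.primeFactors with hT
  have hpos : ∀ {m : Fin r → ℕ}, m ∈ Fintype.piFinset (fun _ : Fin r => S) → ∀ j, m j ≠ 0 := by
    intro m hm j
    have := Finset.mem_Icc.1 (Fintype.mem_piFinset.1 hm j)
    omega
  have haS : ∀ m ∈ S, a m ∈ S' ∧ b m ∈ S := by
    intro m hm
    have hm1 := Finset.mem_Icc.1 hm
    have hm0 : m ≠ 0 := by omega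
    have h := hab m hm0
    have h1 : a m ≠ 0 := fun h0 => hm0 (by rw [h, h0, zero_mul])
    have h2 : b m ≠ 0 := fun h0 => hm0 (by rw [h, h0, mul_zero])
    have h3 : a m ≤ m := Nat.le_of_dvd (by omega) ⟨_, h⟩
    have h4 : b m ≤ m := Nat.le_of_dvd (by omega) ⟨_, by rw [mul_comm]; exact h⟩
    refine ⟨Finset.mem_filter.2 ⟨Finset.mem_Icc.2 ⟨by omega, by omega⟩,
      Nat.primeFactors_subset_of_mem_factoredNumbers (ha m hm0)⟩,
      Finset.mem_Icc.2 ⟨by omega, by omega⟩⟩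
  let G : (Fin r → ℕ) × (Fin r → ℕ) → ℝ := fun x =>
    ((∏ j, (divisorCount k (x.1 j) : ℝ)) / (univ.lcm x.1 : ℕ)) *
      ∏ j, ((divisorCount k (x.2 j) : ℝ) / x.2 j)
  have hG : ∀ x, 0 ≤ G x := fun x => by positivity
  let e : (Fin r → ℕ) → (Fin r → ℕ) × (Fin r → ℕ) := fun m =>
    (fun j => a (m j), fun j => b (m j))
  calc _ ≤ ∑ m ∈ (Fintype.piFinset fun _ : Fin r => S) with
        (∀ s t, s ≠ t → Nat.gcd (m s) (m t) ∣ D), G (e m) := by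
        refine Finset.sum_le_sum fun m hm => ?_
        obtain ⟨hm1, hm2⟩ := Finset.mem_filter.1 hm
        have hm0 := hpos hm1
        have hmeq : m = fun j => a (m j) * b (m j) := funext fun j => hab _ (hm0 j)
        have h1 := one_div_lcm_le_of_factored (a := fun j => a (m j)) (b := fun j => b (m j))
          (fun j => ha _ (hm0 j)) (fun j => hb _ (hm0 j) hD)
          (fun j h0 => hm0 j (by rw [hab _ (hm0 j), h0, mul_zero]))
          (fun s t hst => by rw [← hab _ (hm0 s), ← hab _ (hm0 t)]; exact hm2 s t hst)
        rw [← hmeq] at h1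
        have h2 : ∏ j, (divisorCount k (m j) : ℝ) ≤
            (∏ j, (divisorCount k (a (m j)) : ℝ)) * ∏ j, (divisorCount k (b (m j)) : ℝ) := by
          rw [← Finset.prod_mul_distrib]
          refine Finset.prod_le_prod (fun _ _ => Nat.cast_nonneg _) fun j _ => ?_
          have := divisorCount_mul_le k (a (m j)) (b (m j))
          rw [← hab _ (hm0 j)] at this
          exact_mod_cast this
        calc (∏ j, (divisorCount k (m j) : ℝ)) / (univ.lcm m : ℕ)
            = (∏ j, (divisorCount k (m j) : ℝ)) * (1 / (univ.lcm m : ℕ)) := by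
              rw [mul_one_div]
          _ ≤ ((∏ j, (divisorCount k (a (m j)) : ℝ)) * ∏ j, (divisorCount k (b (m j)) : ℝ)) *
              (1 / ((univ.lcm fun j => a (m j) : ℕ) * ∏ j, (b (m j) : ℝ))) := by
              gcongr
          _ = G (e m) := by
              simp only [G, e, Finset.prod_div_distrib]
              rw [div_mul_div_comm, mul_one_div]
    _ = ∑ x ∈ ((Fintype.piFinset fun _ : Fin r => S).filter fun m =>
        (∀ s t, s ≠ t → Nat.gcd (m s) (m t) ∣ D)).image e, G x := by
        rw [Finset.sum_image]
        intro m hm m' hm' h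
        have hm1 := hpos (Finset.mem_filter.1 hm).1
        have hm2 := hpos (Finset.mem_filter.1 hm').1
        funext j
        have h1 : a (m j) = a (m' j) := congrFun (congrArg Prod.fst h) j
        have h2 : b (m j) = b (m' j) := congrFun (congrArg Prod.snd h) j
        rw [hab _ (hm1 j), hab _ (hm2 j), h1, h2]
    _ ≤ ∑ x ∈ (Fintype.piFinset fun _ : Fin r => S') ×ˢ (Fintype.piFinset fun _ : Fin r => S),
        G x := by
        refine Finset.sum_le_sum_of_subset_of_nonneg ?_ fun x _ _ => hG x
        intro x hx
        obtain ⟨m, hm, rfl⟩ := Finset.mem_image.1 hx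
        have hm1 := Fintype.mem_piFinset.1 (Finset.mem_filter.1 hm).1
        rw [Finset.mem_product, Fintype.mem_piFinset, Fintype.mem_piFinset]
        exact ⟨fun j => (haS _ (hm1 j)).1, fun j => (haS _ (hm1 j)).2⟩
    _ = (∑ m ∈ Fintype.piFinset fun _ : Fin r => S',
          (∏ j, (divisorCount k (m j) : ℝ)) / (univ.lcm m : ℕ)) *
        (∑ b ∈ S, (divisorCount k b : ℝ) / b) ^ r := by
        have hpow : (∑ b ∈ S, (divisorCount k b : ℝ) / b) ^ r =
            ∑ m ∈ Fintype.piFinset fun _ : Fin r => S,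
              ∏ j, ((divisorCount k (m j) : ℝ) / m j) := Finset.sum_pow' _ _ _
        rw [Finset.sum_product, hpow, Finset.sum_mul_sum]
    _ ≤ ((#D.primeFactors : ℝ) + 1) ^ ((k + 1) ^ r) *
        (∑ b ∈ S, (divisorCount k b : ℝ) / b) ^ r := by
        gcongr
        have hTd : ∀ n ∈ T, ∀ d, d ∣ n → d ∈ T := by
          intro n hn d hd
          simp only [hT, Finset.mem_filter, Finset.mem_Icc] at hn ⊢
          have hdn := Nat.le_of_dvd (by omega) hd
          have hd0 := Nat.pos_of_dvd_of_pos hd (by omega)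
          exact ⟨⟨hd0, by omega⟩, (Nat.primeFactors_mono hd (by omega)).trans hn.2⟩
        have hT0 : 0 ∉ T := by simp [hT]
        refine (sum_prod_div_lcm_le S' T (fun n => (divisorCount k n : ℝ))
          (fun _ => Nat.cast_nonneg _) hT0 ?_).trans ?_
        · intro m hm
          have hm' := Fintype.mem_piFinset.1 hm
          refine Finset.mem_filter.2 ⟨lcm_tuple_mem_Icc (Fintype.mem_piFinset.2 fun j =>
            (Finset.mem_filter.1 (hm' j)).1), ?_⟩
          intro p hp
          obtain ⟨hpp, hpd, -⟩ := Nat.mem_primeFactors.1 hp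
          obtain ⟨j, -, hj⟩ := (hpp.prime.dvd_finsetProd_iff _).1
            (hpd.trans (Finset.lcm_dvd_prod univ m))
          have hmj := Finset.mem_filter.1 (hm' j)
          have : m j ≠ 0 := by have := (Finset.mem_Icc.1 hmj.1).1; omega
          exact hmj.2 (Nat.mem_primeFactors.2 ⟨hpp, hj, this⟩)
        · calc ∑ n ∈ T, (∑ a ∈ n.divisors, (divisorCount k a : ℝ)) ^ r / (n : ℝ)
              ≤ ∑ n ∈ T, (divisorCount ((k + 1) ^ r) n : ℝ) / n := by
                refine Finset.sum_le_sum fun n hn => ?_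
                gcongr
                have hn0 : n ≠ 0 := fun h => hT0 (h ▸ hn)
                have := divisorCount_pow_le (k + 1) r n hn0
                rw [← sum_divisors_divisorCount] at this
                exact_mod_cast this
            _ ≤ (∑ n ∈ T, (1 : ℝ) / n) ^ ((k + 1) ^ r) := sum_divisorCount_div_le T hTd _
            _ ≤ _ := by
                gcongr
                refine sum_factoredNumbers_inv_le D.primeFactors
                  (fun p hp => Nat.prime_of_mem_primeFactors hp) T fun n hn => ?_
                obtain ⟨h1, h2⟩ := Finset.mem_filter.1 hn
                exact Nat.mem_factoredNumbers_of_primeFactors_subset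
                  (by have := (Finset.mem_Icc.1 h1).1; omega) h2
    _ = _ := mul_comm _ _

/-! ### Divisor sums along an arithmetic progression -/

/-- The sum of the weights `g m` over the elements `m` of the finite set `S` that divide `z`. -/
noncomputable def divSum (S : Finset ℕ) (g : ℕ → ℝ) (z : ℤ) : ℝ :=
  ∑ m ∈ S with (fun m : ℕ => (m : ℤ) ∣ z) m, g m

lemma divSum_nonneg (S : Finset ℕ) {g : ℕ → ℝ} (hg : ∀ n, 0 ≤ g n) (z : ℤ) :
    0 ≤ divSum S g z := Finset.sum_nonneg fun _ _ => hg _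

lemma prod_divSum {r : ℕ} (S : Finset ℕ) (g : ℕ → ℝ) (z : Fin r → ℤ) :
    ∏ j, divSum S g (z j) = ∑ m ∈ Fintype.piFinset fun _ : Fin r => S,
      if ∀ j, (m j : ℤ) ∣ z j then ∏ j, g (m j) else 0 := by
  simp only [divSum, Finset.sum_filter]
  rw [Finset.prod_univ_sum]
  refine Finset.sum_congr rfl fun m _ => ?_
  split_ifs with h
  · exact Finset.prod_congr rfl fun j _ => if_pos (h j)
  · push Not at h
    obtain ⟨j, hj⟩ := h
    exact Finset.prod_eq_zero (Finset.mem_univ j) (if_neg hj)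

lemma sum_prod_divSum {r : ℕ} (S : Finset ℕ) (g : ℕ → ℝ) (T : Finset ℤ) (z : ℤ → Fin r → ℤ) :
    ∑ t ∈ T, ∏ j, divSum S g (z t j) = ∑ m ∈ Fintype.piFinset fun _ : Fin r => S,
      (#{t ∈ T | ∀ j, (m j : ℤ) ∣ z t j} : ℝ) * ∏ j, g (m j) := by
  simp only [prod_divSum]
  rw [Finset.sum_comm]
  refine Finset.sum_congr rfl fun m _ => ?_
  rw [← Finset.sum_filter, Finset.sum_const, nsmul_eq_mul]

/-- A subset of an interval of length `R` contained in one residue class modulo `l`. -/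
lemma card_le_of_dvd_sub {l : ℕ} (hl : 0 < l) (U : ℤ) (R : ℕ) (T : Finset ℤ)
    (hT : ∀ t ∈ T, t ∈ Ico U (U + R)) (h : ∀ s ∈ T, ∀ t ∈ T, (l : ℤ) ∣ t - s) :
    (#T : ℝ) ≤ R / l + 1 := by
  rcases T.eq_empty_or_nonempty with rfl | ⟨s, hs⟩
  · simp; positivity
  have hsub : T ⊆ {t ∈ Ico U (U + R) | t ≡ s [ZMOD l]} := fun t ht =>
    Finset.mem_filter.2 ⟨hT t ht, (Int.modEq_iff_dvd.2 (h s hs t ht)).symm⟩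
  have h1 := Finset.card_le_card hsub
  have h2 := Int.Ico_filter_modEq_card (r := (l : ℤ)) (a := U) (b := U + R) (by exact_mod_cast hl) s
  have hl' : (0 : ℚ) < l := by exact_mod_cast hl
  have h4 : ((#{t ∈ Ico U (U + R) | t ≡ s [ZMOD l]} : ℤ) : ℚ) ≤ R / l + 1 := by
    rw [h2]
    push_cast
    refine max_le ?_ (by positivity)
    have ha := Int.ceil_lt_add_one (((U : ℚ) + R - s) / (l : ℚ))
    have hb := Int.le_ceil (((U : ℚ) - s) / (l : ℚ))
    have : ((U : ℚ) + R - s) / (l : ℚ) = (U - s) / l + R / l := by ring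
    rw [this] at ha
    rw [this]
    linarith
  have h5 : (#T : ℚ) ≤ R / l + 1 := le_trans (by exact_mod_cast h1) h4
  have h6 : ((#T : ℚ) : ℝ) ≤ ((R / l + 1 : ℚ) : ℝ) := Rat.cast_le.2 h5
  push_cast at h6
  exact h6

/-- The lower bound complementing `card_le_of_dvd_sub` for a full residue class. -/
lemma le_card_of_residue {l : ℕ} (hl : 0 < l) (U : ℤ) (R : ℕ) (s : ℤ) :
    (R : ℝ) / l - 1 ≤ #{t ∈ Ico U (U + R) | t ≡ s [ZMOD l]} := by
  have h2 := Int.Ico_filter_modEq_card (r := (l : ℤ)) (a := U) (b := U + R) (by exact_mod_cast hl) s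
  have hl' : (0 : ℚ) < l := by exact_mod_cast hl
  have h4 : (R : ℚ) / l - 1 ≤ ((#{t ∈ Ico U (U + R) | t ≡ s [ZMOD l]} : ℤ) : ℚ) := by
    rw [h2]
    push_cast
    refine le_trans ?_ (le_max_left _ _)
    have ha := Int.ceil_lt_add_one (((U : ℚ) - s) / (l : ℚ))
    have hb := Int.le_ceil (((U : ℚ) + R - s) / (l : ℚ))
    have : ((U : ℚ) + R - s) / (l : ℚ) = (U - s) / l + R / l := by ring
    rw [this] at hb
    rw [this]
    linarith
  have h5 := Rat.cast_le (K := ℝ).2 h4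
  push_cast at h5
  exact h5

lemma isCoprime_of_dvd_progression {a : ℤ} {q m : ℕ} {t : ℤ} (h : IsCoprime a (q : ℤ))
    (hm : (m : ℤ) ∣ a + q * t) : IsCoprime (m : ℤ) (q : ℤ) :=
  IsCoprime.of_isCoprime_of_dvd_left (by simpa [mul_comm] using h.add_mul_left_left t) hm

/-- The number of `t` in an interval for which all `m_j` divide `a + q (t + i_j)`: the solutions lie
in one residue class modulo the least common multiple. -/
lemma card_simultaneous_le {r : ℕ} {a : ℤ} {q : ℕ} (h : IsCoprime a (q : ℤ)) (m : Fin r → ℕ)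
    (hm : ∀ j, m j ≠ 0) (i : Fin r → ℤ) (U : ℤ) (R : ℕ) :
    (#{t ∈ Ico U (U + R) | ∀ j, (m j : ℤ) ∣ a + q * (t + i j)} : ℝ) ≤
      R / (univ.lcm m : ℕ) + 1 := by
  refine card_le_of_dvd_sub (Nat.pos_of_ne_zero fun h0 => ?_) U R _
    (fun t ht => (Finset.mem_filter.1 ht).1) fun s hs t ht => ?_
  · obtain ⟨j, -, hj⟩ := Finset.lcm_eq_zero_iff.1 h0
    exact hm j hj
  · have hs' := (Finset.mem_filter.1 hs).2
    have ht' := (Finset.mem_filter.1 ht).2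
    rw [Int.natCast_dvd]
    refine Finset.lcm_dvd fun j _ => ?_
    rw [← Int.natCast_dvd]
    refine (isCoprime_of_dvd_progression h (ht' j)).dvd_of_dvd_mul_left ?_
    have := dvd_sub (ht' j) (hs' j)
    have heq : a + q * (t + i j) - (a + q * (s + i j)) = q * (t - s) := by ring
    rwa [heq] at this

/-- Divisors at two places of the progression share only factors of the difference of the
places. -/
lemma gcd_dvd_of_simultaneous {a : ℤ} {q m m' : ℕ} {x y : ℤ} (h : IsCoprime a (q : ℤ))
    (h1 : (m : ℤ) ∣ a + q * x) (h2 : (m' : ℤ) ∣ a + q * y) :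
    ((Nat.gcd m m' : ℕ) : ℤ) ∣ x - y := by
  have g1 : ((Nat.gcd m m' : ℕ) : ℤ) ∣ a + q * x :=
    (Int.natCast_dvd_natCast.2 (Nat.gcd_dvd_left _ _)).trans h1
  have g2 : ((Nat.gcd m m' : ℕ) : ℤ) ∣ a + q * y :=
    (Int.natCast_dvd_natCast.2 (Nat.gcd_dvd_right _ _)).trans h2
  refine (isCoprime_of_dvd_progression h g1).dvd_of_dvd_mul_left ?_
  have := dvd_sub g1 g2
  have heq : a + q * x - (a + q * y) = q * (x - y) := by ring
  rwa [heq] at this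

/-! ### Moments of divisor sums along an arithmetic progression -/

lemma sum_Icc_one_div_le (Q : ℕ) : ∑ n ∈ Icc 1 Q, (1 : ℝ) / n ≤ 1 + Real.log Q := by
  have h := harmonic_le_one_add_log Q
  rw [harmonic_eq_sum_Icc] at h
  push_cast at h
  simpa only [one_div] using h

lemma Icc_one_dvd_closed (Q : ℕ) : ∀ n ∈ Icc 1 Q, ∀ d, d ∣ n → d ∈ Icc 1 Q := by
  intro n hn d hd
  rw [Finset.mem_Icc] at hn ⊢
  exact ⟨Nat.pos_of_dvd_of_pos hd (by omega), (Nat.le_of_dvd (by omega) hd).trans hn.2⟩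

lemma sum_tuples_div_lcm_le (r k M : ℕ) :
    ∑ m ∈ Fintype.piFinset fun _ : Fin r => Icc 1 M,
      (∏ j, (divisorCount k (m j) : ℝ)) / (univ.lcm m : ℕ) ≤
    (1 + r * Real.log M) ^ ((k + 1) ^ r) := by
  refine (sum_prod_div_lcm_le (Icc 1 M) (Icc 1 (M ^ r)) (fun n => (divisorCount k n : ℝ))
    (fun _ => Nat.cast_nonneg _) (by simp) fun m hm => lcm_tuple_mem_Icc hm).trans ?_
  calc ∑ n ∈ Icc 1 (M ^ r), (∑ a ∈ n.divisors, (divisorCount k a : ℝ)) ^ r / (n : ℝ)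
      ≤ ∑ n ∈ Icc 1 (M ^ r), (divisorCount ((k + 1) ^ r) n : ℝ) / n := by
        refine Finset.sum_le_sum fun n hn => ?_
        gcongr
        have hn0 : n ≠ 0 := by rw [Finset.mem_Icc] at hn; omega
        have := divisorCount_pow_le (k + 1) r n hn0
        rw [← sum_divisors_divisorCount] at this
        exact_mod_cast this
    _ ≤ (∑ n ∈ Icc 1 (M ^ r), (1 : ℝ) / n) ^ ((k + 1) ^ r) :=
        sum_divisorCount_div_le _ (Icc_one_dvd_closed _) _
    _ ≤ _ := by
        gcongr
        refine (sum_Icc_one_div_le _).trans_eq ?_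
        rw [Nat.cast_pow, Real.log_pow]

lemma mean_le (k M : ℕ) :
    ∑ b ∈ Icc 1 M, (divisorCount k b : ℝ) / b ≤ (1 + Real.log M) ^ k :=
  (sum_divisorCount_div_le _ (Icc_one_dvd_closed _) _).trans
    (pow_le_pow_left₀ (by positivity) (sum_Icc_one_div_le _) _)

lemma ratio_add_one_le {r M R : ℕ} (hMR : M ^ r ≤ R) {m : Fin r → ℕ}
    (hm : m ∈ Fintype.piFinset fun _ : Fin r => Icc 1 M) :
    (R : ℝ) / (univ.lcm m : ℕ) + 1 ≤ 2 * R * (1 / (univ.lcm m : ℕ)) := by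
  obtain ⟨h1, h2⟩ := Finset.mem_Icc.1 (lcm_tuple_mem_Icc hm)
  have h3 : (0 : ℝ) < (univ.lcm m : ℕ) := by exact_mod_cast h1
  have h4 : ((univ.lcm m : ℕ) : ℝ) ≤ R := by exact_mod_cast h2.trans hMR
  have h5 : 1 ≤ (R : ℝ) / (univ.lcm m : ℕ) := (one_le_div h3).2 h4
  calc (R : ℝ) / (univ.lcm m : ℕ) + 1 ≤ R / (univ.lcm m : ℕ) + R / (univ.lcm m : ℕ) := by gcongr
    _ = _ := by ring

lemma ne_zero_of_mem_tuples {r M : ℕ} {m : Fin r → ℕ}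
    (hm : m ∈ Fintype.piFinset fun _ : Fin r => Icc 1 M) (j : Fin r) : m j ≠ 0 := by
  have := Finset.mem_Icc.1 (Fintype.mem_piFinset.1 hm j)
  omega

/-- Moments with no condition on the places `i_j`, which may coincide. -/
lemma moment_le {a : ℤ} {q : ℕ} (h : IsCoprime a (q : ℤ)) {r M R : ℕ} (k : ℕ) (hMR : M ^ r ≤ R)
    (U : ℤ) (i : Fin r → ℤ) :
    ∑ t ∈ Ico U (U + R), ∏ j, divSum (Icc 1 M) (fun n => divisorCount k n) (a + q * (t + i j)) ≤
      2 * R * (1 + r * Real.log M) ^ ((k + 1) ^ r) := by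
  rw [sum_prod_divSum]
  calc _ ≤ ∑ m ∈ Fintype.piFinset fun _ : Fin r => Icc 1 M,
        2 * R * (1 / (univ.lcm m : ℕ)) * ∏ j, (divisorCount k (m j) : ℝ) := by
        refine Finset.sum_le_sum fun m hm => ?_
        refine mul_le_mul_of_nonneg_right ?_ (by positivity)
        exact (card_simultaneous_le h m (ne_zero_of_mem_tuples hm) i U R).trans
          (ratio_add_one_le hMR hm)
    _ = 2 * R * ∑ m ∈ Fintype.piFinset fun _ : Fin r => Icc 1 M,
        (∏ j, (divisorCount k (m j) : ℝ)) / (univ.lcm m : ℕ) := by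
        rw [Finset.mul_sum]
        refine Finset.sum_congr rfl fun m _ => ?_
        rw [mul_assoc, one_div_mul_eq_div]
    _ ≤ _ := by gcongr; exact sum_tuples_div_lcm_le r k M

lemma card_primeFactors_le_log (n : ℕ) (hn : n ≠ 0) : #n.primeFactors ≤ Nat.log 2 n := by
  refine Nat.le_log_of_pow_le (by norm_num) ?_
  calc 2 ^ #n.primeFactors = ∏ _p ∈ n.primeFactors, 2 := by simp
    _ ≤ ∏ p ∈ n.primeFactors, p :=
        Finset.prod_le_prod' fun p hp => (Nat.prime_of_mem_primeFactors hp).two_le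
    _ ≤ n := Nat.le_of_dvd (Nat.pos_of_ne_zero hn) (Nat.prod_primeFactors_dvd n)

/-- The product of the divisor sums at `r` distinct places of an interval of length `N` has, on
average, the size it would have for independent places, up to a power of `log N`. -/
lemma distinct_moment_le {a : ℤ} {q : ℕ} (h : IsCoprime a (q : ℤ)) {r M R N : ℕ} (k : ℕ)
    (hMR : M ^ r ≤ R) (U : ℤ) (i : Fin r → ℕ) (hi : Function.Injective i) (hiN : ∀ j, i j < N) :
    ∑ t ∈ Ico U (U + R), ∏ j, divSum (Icc 1 M) (fun n => divisorCount k n) (a + q * (t + i j)) ≤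
      2 * R * ((1 + Real.log M) ^ k) ^ r * ((r ^ 2 * Nat.log 2 N : ℕ) + 1 : ℝ) ^ ((k + 1) ^ r) := by
  classical
  -- the product of all differences of places
  let D : ℕ := ∏ p : Fin r × Fin r, if p.1 = p.2 then 1 else ((i p.1 : ℤ) - i p.2).natAbs
  have hne : ∀ s t, s ≠ t → ((i s : ℤ) - i t).natAbs ≠ 0 := by
    intro s t hst h0
    rw [Int.natAbs_eq_zero, sub_eq_zero] at h0
    exact hst (hi (by exact_mod_cast h0))
  have hD : D ≠ 0 := by
    refine Finset.prod_ne_zero_iff.2 fun p _ => ?_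
    split_ifs with hp
    · exact one_ne_zero
    · exact hne _ _ hp
  have hdvd : ∀ s t, s ≠ t → ((i s : ℤ) - i t).natAbs ∣ D := by
    intro s t hst
    have := Finset.dvd_prod_of_mem
      (fun p : Fin r × Fin r => if p.1 = p.2 then 1 else ((i p.1 : ℤ) - i p.2).natAbs)
      (Finset.mem_univ (s, t))
    simpa [hst] using this
  have hcard : #D.primeFactors ≤ r ^ 2 * Nat.log 2 N := by
    have hsub : D.primeFactors ⊆ univ.biUnion fun p : Fin r × Fin r =>
        (if p.1 = p.2 then 1 else ((i p.1 : ℤ) - i p.2).natAbs).primeFactors := by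
      intro x hx
      obtain ⟨hxp, hxd, -⟩ := Nat.mem_primeFactors.1 hx
      obtain ⟨p, -, hp⟩ := (hxp.prime.dvd_finsetProd_iff _).1 hxd
      refine Finset.mem_biUnion.2 ⟨p, Finset.mem_univ _, Nat.mem_primeFactors.2 ⟨hxp, hp, ?_⟩⟩
      split_ifs with hpp
      · exact one_ne_zero
      · exact hne _ _ hpp
    refine (Finset.card_le_card hsub).trans (Finset.card_biUnion_le.trans ?_)
    calc _ ≤ ∑ _p : Fin r × Fin r, Nat.log 2 N := by
          refine Finset.sum_le_sum fun p _ => ?_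
          split_ifs with hpp
          · simp
          · refine (card_primeFactors_le_log _ (hne _ _ hpp)).trans (Nat.log_mono_right ?_)
            have := hiN p.1
            have := hiN p.2
            omega
      _ = r ^ 2 * Nat.log 2 N := by simp [sq]
  rw [sum_prod_divSum]
  calc _ ≤ ∑ m ∈ (Fintype.piFinset fun _ : Fin r => Icc 1 M) with
          (∀ s t, s ≠ t → Nat.gcd (m s) (m t) ∣ D),
        2 * R * (1 / (univ.lcm m : ℕ)) * ∏ j, (divisorCount k (m j) : ℝ) := by
        rw [Finset.sum_filter]
        refine Finset.sum_le_sum fun m hm => ?_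
        split_ifs with hc
        · refine mul_le_mul_of_nonneg_right ?_ (by positivity)
          exact (card_simultaneous_le h m (ne_zero_of_mem_tuples hm) _ U R).trans
            (ratio_add_one_le hMR hm)
        · refine le_of_eq (mul_eq_zero_of_left ?_ _)
          rw [Nat.cast_eq_zero, Finset.card_eq_zero, Finset.filter_eq_empty_iff]
          intro t _ ht
          refine hc fun s s' hs => ?_
          have h1 := gcd_dvd_of_simultaneous h (ht s) (ht s')
          have heq : t + (i s : ℤ) - (t + i s') = i s - i s' := by ring
          rw [heq, Int.natCast_dvd] at h1
          exact h1.trans (hdvd s s' hs)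
    _ = 2 * R * ∑ m ∈ (Fintype.piFinset fun _ : Fin r => Icc 1 M) with
          (∀ s t, s ≠ t → Nat.gcd (m s) (m t) ∣ D),
        (∏ j, (divisorCount k (m j) : ℝ)) / (univ.lcm m : ℕ) := by
        rw [Finset.mul_sum]
        refine Finset.sum_congr rfl fun m _ => ?_
        rw [mul_assoc, one_div_mul_eq_div]
    _ ≤ 2 * R * ((∑ b ∈ Icc 1 M, (divisorCount k b : ℝ) / b) ^ r *
      ((#D.primeFactors : ℝ) + 1) ^ ((k + 1) ^ r)) := by
        gcongr; exact sum_compatible_le hD k M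
    _ ≤ 2 * R * (((1 + Real.log M) ^ k) ^ r *
      ((r ^ 2 * Nat.log 2 N : ℕ) + 1 : ℝ) ^ ((k + 1) ^ r)) := by
        have := mean_le k M
        gcongr
    _ = _ := by ring

lemma exists_dvd_progression {m q : ℕ} (h : Nat.Coprime m q) (a : ℤ) :
    ∃ s : ℤ, ∀ t : ℤ, (m : ℤ) ∣ a + q * t ↔ t ≡ s [ZMOD m] := by
  obtain ⟨u, v, huv⟩ := (Nat.isCoprime_iff_coprime.2 h : IsCoprime (m : ℤ) (q : ℤ))
  refine ⟨-(a * v), fun t => ?_⟩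
  rw [Int.modEq_comm, Int.modEq_iff_dvd]
  have h1 : a + q * t = q * (t - -(a * v)) + m * (u * a) := by linear_combination (-a) * huv
  rw [h1, Int.dvd_add_left (dvd_mul_right _ _)]
  exact ⟨fun hd => (Nat.isCoprime_iff_coprime.2 h).dvd_of_dvd_mul_left hd,
    fun hd => hd.mul_left _⟩

lemma card_pairs_le (N g : ℕ) (hg : 0 < g) :
    (#{p ∈ range N ×ˢ range N | (g : ℤ) ∣ (p.1 : ℤ) - p.2} : ℝ) ≤ N * (N / g + 1) := by
  have hcard : #{p ∈ range N ×ˢ range N | (g : ℤ) ∣ (p.1 : ℤ) - p.2} =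
      ∑ y ∈ range N, #{x ∈ range N | (g : ℤ) ∣ ((x : ℕ) : ℤ) - (y : ℕ)} := by
    rw [Finset.card_filter, Finset.sum_product_right]
    exact Finset.sum_congr rfl fun y _ => (Finset.card_filter _ _).symm
  rw [hcard]
  push_cast
  calc _ ≤ ∑ _y ∈ range N, ((N : ℝ) / g + 1) := by
        refine Finset.sum_le_sum fun y _ => ?_
        have h1 := card_le_of_dvd_sub hg 0 N
          (({x ∈ range N | (g : ℤ) ∣ ((x : ℕ) : ℤ) - (y : ℕ)}).image fun x : ℕ => (x : ℤ)) ?_ ?_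
        · rwa [Finset.card_image_of_injective _ Nat.cast_injective] at h1
        · intro t ht
          obtain ⟨x, hx, rfl⟩ := Finset.mem_image.1 ht
          have := Finset.mem_range.1 (Finset.mem_filter.1 hx).1
          rw [Finset.mem_Ico]
          omega
        · intro s hs t ht
          obtain ⟨x, hx, rfl⟩ := Finset.mem_image.1 hs
          obtain ⟨x', hx', rfl⟩ := Finset.mem_image.1 ht
          have := dvd_sub (Finset.mem_filter.1 hx').2 (Finset.mem_filter.1 hx).2
          simpa using this
    _ = _ := by simp [mul_add]

/-- A lower bound for the first moment, needed to complete the square in the variance. -/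
lemma sum_range_divSum_ge {a : ℤ} {q : ℕ} (S : Finset ℕ) (hS : ∀ m ∈ S, 0 < m ∧ m.Coprime q)
    {g : ℕ → ℝ} (hg : ∀ n, 0 ≤ g n) (U : ℤ) (R N : ℕ) :
    N * R * (∑ m ∈ S, g m / m) - N * ∑ m ∈ S, g m ≤
      ∑ t ∈ Ico U (U + R), ∑ i ∈ range N, divSum S g (a + q * (t + i)) := by
  rw [Finset.sum_comm]
  have key : ∀ i ∈ range N, R * (∑ m ∈ S, g m / m) - ∑ m ∈ S, g m ≤
      ∑ t ∈ Ico U (U + R), divSum S g (a + q * (t + (i : ℕ))) := by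
    intro i _
    simp only [divSum, Finset.sum_filter]
    rw [Finset.sum_comm, Finset.mul_sum, ← Finset.sum_sub_distrib]
    refine Finset.sum_le_sum fun m hm => ?_
    obtain ⟨s, hs⟩ := exists_dvd_progression (hS m hm).2 (a + q * i)
    have h1 := le_card_of_residue (hS m hm).1 U R s
    rw [← Finset.sum_filter, Finset.sum_const, nsmul_eq_mul]
    have h2 : {t ∈ Ico U (U + R) | (m : ℤ) ∣ a + q * (t + (i : ℕ))} =
        {t ∈ Ico U (U + R) | t ≡ s [ZMOD m]} := by
      refine Finset.filter_congr fun t _ => ?_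
      rw [← hs t]
      have : a + q * (t + (i : ℕ)) = a + q * (i : ℕ) + q * t := by ring
      rw [this]
    rw [h2]
    calc (R : ℝ) * (g m / m) - g m = (R / m - 1) * g m := by ring
      _ ≤ _ := mul_le_mul_of_nonneg_right h1 (hg m)
  calc _ = ∑ _i ∈ range N, (R * (∑ m ∈ S, g m / m) - ∑ m ∈ S, g m) := by
        rw [Finset.sum_const, Finset.card_range, nsmul_eq_mul]; ring
    _ ≤ _ := Finset.sum_le_sum key

/-- The second moment. The first term on the right is the square of the mean, which cancels in the
variance; the second comes from the pairs of places closer than a common factor of `m` and `m'`. -/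
lemma sum_sq_range_divSum_le {a : ℤ} {q : ℕ} (h : IsCoprime a (q : ℤ)) (S : Finset ℕ)
    (hS : ∀ m ∈ S, 0 < m) {g : ℕ → ℝ} (hg : ∀ n, 0 ≤ g n) (U : ℤ) (R N : ℕ) :
    ∑ t ∈ Ico U (U + R), (∑ i ∈ range N, divSum S g (a + q * (t + i))) ^ 2 ≤
      N ^ 2 * R * (∑ m ∈ S, g m / m) ^ 2 +
      N * R * (∑ m ∈ Fintype.piFinset fun _ : Fin 2 => S, (∏ j, g (m j)) / (univ.lcm m : ℕ)) +
      2 * N ^ 2 * (∑ m ∈ S, g m) ^ 2 := by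
  have hpow1 : (∑ m ∈ S, g m / m) ^ 2 =
      ∑ m ∈ Fintype.piFinset fun _ : Fin 2 => S, ∏ j, g (m j) / m j := Finset.sum_pow' _ _ _
  have hpow2 : (∑ m ∈ S, g m) ^ 2 =
      ∑ m ∈ Fintype.piFinset fun _ : Fin 2 => S, ∏ j, g (m j) := Finset.sum_pow' _ _ _
  calc _ = ∑ p ∈ range N ×ˢ range N, ∑ t ∈ Ico U (U + R),
        ∏ j : Fin 2, divSum S g (a + q * (t + (![(p.1 : ℤ), p.2] j))) := by
        rw [Finset.sum_comm]
        refine Finset.sum_congr rfl fun t _ => ?_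
        rw [sq, Finset.sum_mul_sum, ← Finset.sum_product']
        simp [Fin.prod_univ_two]
    _ = ∑ m ∈ Fintype.piFinset fun _ : Fin 2 => S, (∑ p ∈ range N ×ˢ range N,
        (#{t ∈ Ico U (U + R) | ∀ j : Fin 2, (m j : ℤ) ∣ a + q * (t + (![(p.1 : ℤ), p.2] j))} : ℝ)) *
          ∏ j, g (m j) := by
        simp only [sum_prod_divSum]
        rw [Finset.sum_comm]
        exact Finset.sum_congr rfl fun m _ => (Finset.sum_mul _ _ _).symm
    _ ≤ ∑ m ∈ Fintype.piFinset fun _ : Fin 2 => S, (N ^ 2 * R * (1 / (m 0 * m 1)) +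
        N * R * (1 / (univ.lcm m : ℕ)) + 2 * N ^ 2) * ∏ j, g (m j) := by
        refine Finset.sum_le_sum fun m hm => ?_
        refine mul_le_mul_of_nonneg_right ?_ (Finset.prod_nonneg fun _ _ => hg _)
        have hmp : ∀ j, 0 < m j := fun j => hS _ (Fintype.mem_piFinset.1 hm j)
        have hlcm : univ.lcm m = Nat.lcm (m 0) (m 1) := by
          have : (univ : Finset (Fin 2)) = {0, 1} := by decide
          rw [this, Finset.lcm_insert, Finset.lcm_singleton]
          simp [lcm_eq_nat_lcm]
        have hgl : ((Nat.gcd (m 0) (m 1) : ℕ) : ℝ) * (univ.lcm m : ℕ) = m 0 * m 1 := by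
          rw [hlcm]; exact_mod_cast Nat.gcd_mul_lcm _ _
        have hgp : 0 < Nat.gcd (m 0) (m 1) := Nat.gcd_pos_of_pos_left _ (hmp 0)
        have hlp : 0 < univ.lcm m := by rw [hlcm]; exact Nat.lcm_pos (hmp 0) (hmp 1)
        have hgR : (1 : ℝ) ≤ (Nat.gcd (m 0) (m 1) : ℕ) := by exact_mod_cast hgp
        have hlR : (1 : ℝ) ≤ (univ.lcm m : ℕ) := by exact_mod_cast hlp
        rw [← hgl]
        set G : ℝ := ((Nat.gcd (m 0) (m 1) : ℕ) : ℝ)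
        set K : ℝ := ((univ.lcm m : ℕ) : ℝ)
        calc _ ≤ ∑ p ∈ range N ×ˢ range N,
              if ((Nat.gcd (m 0) (m 1) : ℕ) : ℤ) ∣ (p.1 : ℤ) - p.2 then (R : ℝ) / K + 1 else 0 := by
              refine Finset.sum_le_sum fun p _ => ?_
              split_ifs with hd
              · exact card_simultaneous_le h m (fun j => (hmp j).ne') _ U R
              · refine le_of_eq ?_
                rw [Nat.cast_eq_zero, Finset.card_eq_zero, Finset.filter_eq_empty_iff]
                intro t _ ht
                refine hd ?_
                have h1 := gcd_dvd_of_simultaneous h (ht 0) (ht 1)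
                simpa using h1
          _ = (#{p ∈ range N ×ˢ range N | ((Nat.gcd (m 0) (m 1) : ℕ) : ℤ) ∣ (p.1 : ℤ) - p.2} : ℝ) *
              (R / K + 1) := by
              rw [← Finset.sum_filter, Finset.sum_const, nsmul_eq_mul]
          _ ≤ N * (N / G + 1) * (R / K + 1) := by
              gcongr
              exact card_pairs_le N _ hgp
          _ = N ^ 2 * R * (1 / (G * K)) + N * R * (1 / K) + (N ^ 2 / G + N) := by
              field_simp
          _ ≤ _ := by
              gcongr
              have h1 : (N : ℝ) ^ 2 / G ≤ N ^ 2 := div_le_self (by positivity) hgR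
              have h2 : (N : ℝ) ≤ N ^ 2 := by exact_mod_cast Nat.le_self_pow (by norm_num) N
              linarith
    _ = _ := by
        rw [hpow1, hpow2, Finset.mul_sum, Finset.mul_sum, Finset.mul_sum,
          ← Finset.sum_add_distrib, ← Finset.sum_add_distrib]
        refine Finset.sum_congr rfl fun m _ => ?_
        rw [Fin.prod_univ_two, Fin.prod_univ_two]
        ring

/-- The variance of a divisor sum over intervals of length `N` of a progression. -/
lemma variance_le {a : ℤ} {q : ℕ} (h : IsCoprime a (q : ℤ)) (S : Finset ℕ)
    (hS : ∀ m ∈ S, 0 < m ∧ m.Coprime q) {g : ℕ → ℝ} (hg : ∀ n, 0 ≤ g n) (U : ℤ) (R N : ℕ) :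
    ∑ t ∈ Ico U (U + R), ((∑ i ∈ range N, divSum S g (a + q * (t + i))) -
        N * ∑ m ∈ S, g m / m) ^ 2 ≤
      N * R * (∑ m ∈ Fintype.piFinset fun _ : Fin 2 => S, (∏ j, g (m j)) / (univ.lcm m : ℕ)) +
      4 * N ^ 2 * (∑ m ∈ S, g m) ^ 2 := by
  have h1 := sum_range_divSum_ge (a := a) S hS hg U R N
  have h2 := sum_sq_range_divSum_le h S (fun m hm => (hS m hm).1) hg U R N
  have hμF : ∑ m ∈ S, g m / m ≤ ∑ m ∈ S, g m := by
    refine Finset.sum_le_sum fun m hm => div_le_self (hg m) ?_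
    exact_mod_cast (hS m hm).1
  have hμ0 : 0 ≤ ∑ m ∈ S, g m / (m : ℝ) :=
    Finset.sum_nonneg fun m _ => div_nonneg (hg m) (Nat.cast_nonneg _)
  generalize ∑ m ∈ S, g m / (m : ℝ) = μ at *
  set F := ∑ m ∈ S, g m
  set V := ∑ m ∈ Fintype.piFinset fun _ : Fin 2 => S, (∏ j, g (m j)) / (univ.lcm m : ℕ)
  have hexp : ∑ t ∈ Ico U (U + R), ((∑ i ∈ range N, divSum S g (a + q * (t + i))) - N * μ) ^ 2 =
      ∑ t ∈ Ico U (U + R), (∑ i ∈ range N, divSum S g (a + q * (t + i))) ^ 2 -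
      2 * (N * μ) * ∑ t ∈ Ico U (U + R), ∑ i ∈ range N, divSum S g (a + q * (t + i)) +
      R * (N * μ) ^ 2 := by
    simp only [sub_sq, Finset.sum_add_distrib, Finset.sum_sub_distrib]
    rw [Finset.mul_sum (Ico U (U + R))]
    simp only [Finset.sum_const, Int.card_Ico, add_sub_cancel_left, Int.toNat_natCast, nsmul_eq_mul]
    congr 2
    exact Finset.sum_congr rfl fun t _ => by ring
  rw [hexp]
  have h3 : 2 * (N * μ) * (N * R * μ - N * F) ≤
      2 * (N * μ) * ∑ t ∈ Ico U (U + R), ∑ i ∈ range N, divSum S g (a + q * (t + i)) := by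
    gcongr
  have h4 : 2 * (N * μ) * (N * F) ≤ 2 * (N : ℝ) ^ 2 * F ^ 2 := by
    have : μ * F ≤ F * F := mul_le_mul_of_nonneg_right hμF (hμ0.trans hμF)
    nlinarith [sq_nonneg (N : ℝ)]
  linarith

/-! ### Counting the exceptional places -/

/-- If no term is large, a large sum forces the sum over tuples of distinct indices to be large. -/
lemma pow_le_sum_injective (I : Finset ℕ) (w : ℕ → ℝ) {c : ℝ} (hw : ∀ i ∈ I, 0 ≤ w i)
    (hc : ∀ i ∈ I, w i ≤ c) (r : ℕ) (hr : 2 * r * c ≤ ∑ i ∈ I, w i) :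
    ((∑ i ∈ I, w i) / 2) ^ r ≤
      ∑ i ∈ (Fintype.piFinset fun _ : Fin r => I) with (fun i => Function.Injective i) i,
        ∏ j, w (i j) := by
  classical
  rcases I.eq_empty_or_nonempty with rfl | ⟨x₀, hx₀⟩
  · cases r with
    | zero =>
      rw [Finset.filter_true_of_mem fun i _ => Function.injective_of_subsingleton i]
      simp
    | succ r => simp
  have hc0 : 0 ≤ c := (hw x₀ hx₀).trans (hc x₀ hx₀)
  induction r with
  | zero =>
    rw [Finset.filter_true_of_mem fun i _ => Function.injective_of_subsingleton i]
    simp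
  | succ r ih =>
    set S := ∑ i ∈ I, w i with hS
    have hS0 : 0 ≤ S := Finset.sum_nonneg hw
    have hr' : 2 * (r : ℝ) * c ≤ S := by push_cast at hr; nlinarith
    have hin := ih hr'
    set P := (Fintype.piFinset fun _ : Fin r => I).filter fun i => Function.Injective i with hP
    have hPw : ∀ i ∈ P, 0 ≤ ∏ j, w (i j) := fun i hi =>
      Finset.prod_nonneg fun j _ => hw _ (Fintype.mem_piFinset.1 (Finset.mem_filter.1 hi).1 j)
    calc (S / 2) ^ (r + 1) = (S / 2) ^ r * (S / 2) := pow_succ _ _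
      _ ≤ (∑ i ∈ P, ∏ j, w (i j)) * (S / 2) := by gcongr
      _ = ∑ i ∈ P, (∏ j, w (i j)) * (S / 2) := Finset.sum_mul _ _ _
      _ ≤ ∑ i ∈ P, (∏ j, w (i j)) * ∑ x ∈ I \ univ.image i, w x := by
          refine Finset.sum_le_sum fun i hi => mul_le_mul_of_nonneg_left ?_ (hPw i hi)
          have hsub : univ.image i ⊆ I := by
            intro x hx
            obtain ⟨j, -, rfl⟩ := Finset.mem_image.1 hx
            exact Fintype.mem_piFinset.1 (Finset.mem_filter.1 hi).1 j
          have h1 := Finset.sum_sdiff (f := w) hsub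
          have h2 : ∑ x ∈ univ.image i, w x ≤ r * c := by
            calc _ ≤ #(univ.image i) • c :=
                  Finset.sum_le_card_nsmul _ _ _ fun x hx => hc x (hsub hx)
              _ ≤ _ := by
                  rw [nsmul_eq_mul]
                  gcongr
                  simpa using Finset.card_image_le (s := (univ : Finset (Fin r))) (f := i)
          linarith
      _ = ∑ s ∈ P.sigma fun i => I \ univ.image i,
            ∏ j, w ((Fin.cons s.2 s.1 : Fin (r + 1) → ℕ) j) := by
          rw [Finset.sum_sigma]
          refine Finset.sum_congr rfl fun i _ => ?_
          rw [Finset.mul_sum]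
          refine Finset.sum_congr rfl fun x _ => ?_
          rw [Fin.prod_univ_succ]
          simp [mul_comm]
      _ = ∑ i ∈ (P.sigma fun i => I \ univ.image i).image
            fun s => (Fin.cons s.2 s.1 : Fin (r + 1) → ℕ), ∏ j, w (i j) := by
          rw [Finset.sum_image]
          rintro ⟨i, x⟩ _ ⟨i', x'⟩ _ heq
          obtain ⟨h1, h2⟩ := Fin.cons_inj.1 heq
          simp only at h1 h2
          subst h1 h2
          rfl
      _ ≤ _ := by
          refine Finset.sum_le_sum_of_subset_of_nonneg ?_ fun i hi _ =>
            Finset.prod_nonneg fun j _ =>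
              hw _ (Fintype.mem_piFinset.1 (Finset.mem_filter.1 hi).1 j)
          intro y hy
          obtain ⟨⟨i, x⟩, hs, rfl⟩ := Finset.mem_image.1 hy
          obtain ⟨hi, hx⟩ := Finset.mem_sigma.1 hs
          obtain ⟨hi1, hi2⟩ := Finset.mem_filter.1 hi
          obtain ⟨hx1, hx2⟩ := Finset.mem_sdiff.1 hx
          refine Finset.mem_filter.2 ⟨Fintype.mem_piFinset.2 fun j => ?_, ?_⟩
          · refine Fin.cases ?_ (fun j => ?_) j
            · simpa using hx1
            · simpa using Fintype.mem_piFinset.1 hi1 j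
          · exact Fin.cons_injective_iff.2 ⟨by simpa using hx2, hi2⟩

/-- Markov's inequality for the counting measure. -/
lemma card_mul_le_sum {T : Finset ℤ} {f : ℤ → ℝ} {c : ℝ} (B : Finset ℤ) (hB : B ⊆ T)
    (hf : ∀ t ∈ T, 0 ≤ f t) (hc : ∀ t ∈ B, c ≤ f t) : #B * c ≤ ∑ t ∈ T, f t := by
  rw [← nsmul_eq_mul]
  exact (Finset.card_nsmul_le_sum _ _ _ hc).trans
    (Finset.sum_le_sum_of_subset_of_nonneg hB fun t ht _ => hf t ht)

lemma divSum_mono {S S' : Finset ℕ} (hS : S ⊆ S') {g g' : ℕ → ℝ} (hg : ∀ n ∈ S, g n ≤ g' n)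
    (hg' : ∀ n, 0 ≤ g' n) (z : ℤ) : divSum S g z ≤ divSum S' g' z := by
  unfold divSum
  calc _ ≤ ∑ m ∈ S with (fun m : ℕ => (m : ℤ) ∣ z) m, g' m :=
        Finset.sum_le_sum fun m hm => hg m (Finset.mem_filter.1 hm).1
    _ ≤ _ := Finset.sum_le_sum_of_subset_of_nonneg (Finset.filter_subset_filter _ hS)
        fun _ _ _ => hg' _

lemma divSum_const_mul (S : Finset ℕ) (g : ℕ → ℝ) (Q : ℝ) (z : ℤ) :
    divSum S (fun n => Q * g n) z = Q * divSum S g z := by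
  unfold divSum
  rw [Finset.mul_sum]

/-- Third moment bound for the places near which a single divisor sum is large. -/
lemma card_exists_large_le {a : ℤ} {q : ℕ} (h : IsCoprime a (q : ℤ)) {S : Finset ℕ} {M R : ℕ}
    (hS : S ⊆ Icc 1 M) {g : ℕ → ℝ} {Q : ℝ} (hg0 : ∀ n, 0 ≤ g n) (hgQ : ∀ n ∈ S, g n ≤ Q)
    (hQ : 0 ≤ Q) (hMR : M ^ 3 ≤ R) (U : ℤ) (N : ℕ) {c : ℝ} (hc : 0 < c) (B : Finset ℤ)
    (hB : B ⊆ Ico U (U + R))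
    (hB' : ∀ t ∈ B, ∃ i ∈ range N, c ≤ divSum S g (a + q * (t + (i : ℕ)))) :
    (#B : ℝ) ≤ N * (Q ^ 3 * (2 * R * (1 + 3 * Real.log M) ^ 8)) / c ^ 3 := by
  rw [le_div_iff₀ (by positivity)]
  have hnn := divSum_nonneg S hg0
  refine (card_mul_le_sum (T := Ico U (U + R))
    (f := fun t => ∑ i ∈ range N, divSum S g (a + q * (t + (i : ℕ))) ^ 3) B hB
    (fun t _ => Finset.sum_nonneg fun i _ => pow_nonneg (hnn _) 3) fun t ht => ?_).trans ?_
  · obtain ⟨i, hi, hci⟩ := hB' t ht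
    exact (pow_le_pow_left₀ hc.le hci 3).trans (Finset.single_le_sum
      (f := fun i : ℕ => divSum S g (a + q * (t + (i : ℕ))) ^ 3)
      (fun i _ => pow_nonneg (hnn _) 3) hi)
  · rw [Finset.sum_comm]
    calc _ ≤ ∑ _i ∈ range N, Q ^ 3 * (2 * R * (1 + 3 * Real.log M) ^ 8) := by
          refine Finset.sum_le_sum fun i _ => ?_
          -- with `d_1 = 1` the divisor sum counts divisors, and the exponent is `2 ^ 3 = 8`
          have h1 := moment_le h 1 hMR U (fun _ : Fin 3 => (i : ℤ))
          simp only [Finset.prod_const, Finset.card_univ, Fintype.card_fin] at h1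
          norm_num at h1
          refine le_trans ?_ (mul_le_mul_of_nonneg_left h1 (pow_nonneg hQ 3))
          rw [Finset.mul_sum]
          refine Finset.sum_le_sum fun t _ => ?_
          rw [← mul_pow, ← divSum_const_mul]
          refine pow_le_pow_left₀ (hnn _) (divSum_mono hS (fun n hn => ?_) (fun n => by positivity)
            _) 3
          have hn0 : n ≠ 0 := by have := Finset.mem_Icc.1 (hS hn); omega
          have : divisorCount 1 n = 1 := by
            rw [divisorCount_eq_zeta_pow, pow_one, ArithmeticFunction.zeta_apply_ne hn0]
          rw [this, Nat.cast_one, mul_one]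
          exact hgQ n hn
      _ = _ := by rw [Finset.sum_const, Finset.card_range, nsmul_eq_mul]

/-- The number of places where the divisor sum over `N` consecutive terms exceeds `T`: either a
single term exceeds `T / 2r`, or many `r`-tuples of distinct terms contribute. -/
lemma card_exceptional_le {a : ℤ} {q : ℕ} (h : IsCoprime a (q : ℤ)) {S : Finset ℕ} {M R : ℕ}
    (hS : S ⊆ Icc 1 M) {g : ℕ → ℝ} {Q : ℝ} {k : ℕ} (hg0 : ∀ n, 0 ≤ g n)
    (hgQ : ∀ n ∈ S, g n ≤ Q) (hgk : ∀ n ∈ S, g n ≤ divisorCount k n) (hQ : 0 ≤ Q) {r : ℕ}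
    (hr : 0 < r) (hM3 : M ^ 3 ≤ R) (hMR : M ^ r ≤ R) (U : ℤ) (N : ℕ) {T : ℝ} (hT : 0 < T) :
    (#{t ∈ Ico U (U + R) | T < ∑ i ∈ range N, divSum S g (a + q * (t + i))} : ℝ) ≤
      N * (Q ^ 3 * (2 * R * (1 + 3 * Real.log M) ^ 8)) / (T / (2 * r)) ^ 3 +
      N ^ r * (2 * R * ((1 + Real.log M) ^ k) ^ r *
        ((r ^ 2 * Nat.log 2 N : ℕ) + 1 : ℝ) ^ ((k + 1) ^ r)) / (T / 2) ^ r := by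
  classical
  have hnn := divSum_nonneg S hg0
  have hc : 0 < T / (2 * r) := by positivity
  set B := {t ∈ Ico U (U + R) | T < ∑ i ∈ range N, divSum S g (a + q * (t + i))} with hBdef
  set B₁ := {t ∈ B | ∃ i ∈ range N, T / (2 * r) ≤ divSum S g (a + q * (t + (i : ℕ)))} with hB₁
  set B₂ := {t ∈ B | ¬ ∃ i ∈ range N, T / (2 * r) ≤ divSum S g (a + q * (t + (i : ℕ)))} with hB₂
  have hcard : (#B : ℝ) = #B₁ + #B₂ := by
    exact_mod_cast (Finset.card_filter_add_card_filter_not _).symm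
  have hBsub : B ⊆ Ico U (U + R) := Finset.filter_subset _ _
  rw [hcard]
  refine add_le_add ?_ ?_
  · exact card_exists_large_le h hS hg0 hgQ hQ hM3 U N hc B₁
      ((Finset.filter_subset _ _).trans hBsub) fun t ht => (Finset.mem_filter.1 ht).2
  · rw [le_div_iff₀ (by positivity)]
    refine (card_mul_le_sum (T := Ico U (U + R)) (f := fun t =>
      ∑ i ∈ (Fintype.piFinset fun _ : Fin r => range N) with (fun i => Function.Injective i) i,
        ∏ j, divSum S g (a + q * (t + (i j : ℕ)))) B₂ ((Finset.filter_subset _ _).trans hBsub)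
      (fun t _ => Finset.sum_nonneg fun i _ => Finset.prod_nonneg fun j _ => hnn _)
      fun t ht => ?_).trans ?_
    · obtain ⟨h1, h2⟩ := Finset.mem_filter.1 ht
      push Not at h2
      have h3 := (Finset.mem_filter.1 h1).2
      refine (pow_le_pow_left₀ (by positivity) (by linarith) r).trans
        (pow_le_sum_injective (range N) (fun i => divSum S g (a + q * (t + (i : ℕ))))
          (c := T / (2 * r)) (fun i _ => hnn _) (fun i hi => (h2 i hi).le) r ?_)
      have : 2 * (r : ℝ) * (T / (2 * r)) = T := by field_simp
      rw [this]
      exact h3.le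
    · rw [Finset.sum_comm]
      calc _ ≤ ∑ _i ∈ (Fintype.piFinset fun _ : Fin r => range N) with
              (fun i => Function.Injective i) _i, (2 * R * ((1 + Real.log M) ^ k) ^ r *
                ((r ^ 2 * Nat.log 2 N : ℕ) + 1 : ℝ) ^ ((k + 1) ^ r)) := by
            refine Finset.sum_le_sum fun i hi => ?_
            obtain ⟨hi1, hi2⟩ := Finset.mem_filter.1 hi
            refine le_trans ?_ (distinct_moment_le h k hMR U i hi2 fun j =>
              Finset.mem_range.1 (Fintype.mem_piFinset.1 hi1 j))
            refine Finset.sum_le_sum fun t _ => ?_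
            exact Finset.prod_le_prod (fun j _ => hnn _) fun j _ =>
              divSum_mono hS hgk (fun _ => Nat.cast_nonneg _) _
        _ ≤ _ := by
            rw [Finset.sum_const, nsmul_eq_mul]
            have hM0 : 0 ≤ Real.log M := Real.log_natCast_nonneg _
            refine mul_le_mul_of_nonneg_right ?_ (by positivity)
            have h1 := Finset.card_filter_le (Fintype.piFinset fun _ : Fin r => range N)
              (fun i => Function.Injective i)
            rw [Fintype.card_piFinset] at h1
            simp only [Finset.card_range, Finset.prod_const, Finset.card_univ,
              Fintype.card_fin] at h1
            exact_mod_cast h1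

/-- Chebyshev's inequality for the divisor sum over `N` consecutive terms. -/
lemma card_exceptional_le_of_variance {a : ℤ} {q : ℕ} (h : IsCoprime a (q : ℤ)) {S : Finset ℕ}
    {M R : ℕ} (hS : S ⊆ Icc 1 M) (hSq : ∀ m ∈ S, m.Coprime q) (k : ℕ) (U : ℤ) (N : ℕ) {τ T : ℝ}
    (hτ : (1 + Real.log M) ^ k ≤ τ) (hτ0 : 0 < τ) (hN : 0 < N) (hT : 2 * N * τ ≤ T) :
    (#{t ∈ Ico U (U + R) | T < ∑ i ∈ range N,
        divSum S (fun n => divisorCount k n) (a + q * (t + i))} : ℝ) ≤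
      R * (1 + 2 * Real.log M) ^ ((k + 1) ^ 2) / (N * τ ^ 2) + 4 * M ^ 2 := by
  have hSpos : ∀ m ∈ S, 0 < m := fun m hm => by have := Finset.mem_Icc.1 (hS hm); omega
  have hg : ∀ n, (0 : ℝ) ≤ (fun n => (divisorCount k n : ℝ)) n := fun _ => Nat.cast_nonneg _
  have hvar := variance_le h S (fun m hm => ⟨hSpos m hm, hSq m hm⟩) hg U R N
  have hNpos : (0 : ℝ) < N := by exact_mod_cast hN
  have hμ : ∑ m ∈ S, (divisorCount k m : ℝ) / m ≤ τ :=
    (Finset.sum_le_sum_of_subset_of_nonneg hS fun _ _ _ => by positivity).trans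
      ((mean_le k M).trans hτ)
  have hF : ∑ m ∈ S, (divisorCount k m : ℝ) ≤ M * τ := by
    calc ∑ m ∈ S, (divisorCount k m : ℝ) ≤ ∑ m ∈ S, M * ((divisorCount k m : ℝ) / m) := by
          refine Finset.sum_le_sum fun m hm => ?_
          have h1 : (0 : ℝ) < m := by exact_mod_cast hSpos m hm
          have h2 : (m : ℝ) ≤ M := by exact_mod_cast (Finset.mem_Icc.1 (hS hm)).2
          rw [mul_div_assoc', le_div_iff₀ h1, mul_comm]
          gcongr
      _ = M * ∑ m ∈ S, (divisorCount k m : ℝ) / m := (Finset.mul_sum _ _ _).symm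
      _ ≤ _ := by gcongr
  have hF0 : 0 ≤ ∑ m ∈ S, (divisorCount k m : ℝ) := Finset.sum_nonneg fun _ _ => hg _
  have hV : ∑ m ∈ Fintype.piFinset fun _ : Fin 2 => S,
      (∏ j, (divisorCount k (m j) : ℝ)) / (univ.lcm m : ℕ) ≤
      (1 + 2 * Real.log M) ^ ((k + 1) ^ 2) := by
    refine (Finset.sum_le_sum_of_subset_of_nonneg
      (Fintype.piFinset_subset _ _ fun _ => hS) fun _ _ _ => by positivity).trans ?_
    have := sum_tuples_div_lcm_le 2 k M
    push_cast at this
    exact this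
  set B := {t ∈ Ico U (U + R) | T < ∑ i ∈ range N,
        divSum S (fun n => divisorCount k n) (a + q * (t + i))} with hB
  have h1 := card_mul_le_sum (c := ((N : ℝ) * τ) ^ 2) B (Finset.filter_subset _ _)
    (fun t _ => sq_nonneg ((∑ i ∈ range N,
        divSum S (fun n => divisorCount k n) (a + q * (t + i))) -
        N * ∑ m ∈ S, (divisorCount k m : ℝ) / m)) fun t ht => by
      have h2 := (Finset.mem_filter.1 ht).2
      refine pow_le_pow_left₀ (by positivity) ?_ 2
      have : (N : ℝ) * ∑ m ∈ S, (divisorCount k m : ℝ) / m ≤ N * τ := by gcongr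
      linarith
  have h2 : (#B : ℝ) * ((N : ℝ) * τ) ^ 2 ≤
      N * R * (1 + 2 * Real.log M) ^ ((k + 1) ^ 2) + 4 * N ^ 2 * (M * τ) ^ 2 := by
    refine h1.trans (hvar.trans ?_)
    gcongr
  have h3 : (N * R * (1 + 2 * Real.log M) ^ ((k + 1) ^ 2) + 4 * N ^ 2 * (M * τ) ^ 2) =
      (R * (1 + 2 * Real.log M) ^ ((k + 1) ^ 2) / (N * τ ^ 2) + 4 * M ^ 2) *
        ((N : ℝ) * τ) ^ 2 := by
    field_simp
  rw [h3] at h2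
  exact le_of_mul_le_mul_right h2 (by positivity)

/-! ### From real intervals to an arithmetic progression -/

/-- The divisors counted by `dTilde` at integers coprime to `q`. -/
noncomputable def majorantSupport (k : ℕ) (ε' X : ℝ) (q : ℕ) : Finset ℕ :=
  {m ∈ Icc 1 ⌊truncLevel k X⌋₊ | (ArithmeticFunction.cardFactors m : ℝ) ≤
    (1 + ε') * k * Real.log (Real.log X) ∧ m.Coprime q}

lemma dTilde_le_divSum {k : ℕ} {ε' X : ℝ} {a : ℤ} {q n : ℕ} (h : IsCoprime a (q : ℤ))
    (hn : (n : ℤ) ≡ a [ZMOD (q : ℤ)]) (hX : 0 ≤ X) :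
    dTilde k ε' X n ≤
      divSum (majorantSupport k ε' X q) (fun m => divisorCount (k - 1) m) (n : ℤ) := by
  unfold dTilde
  split_ifs with hc
  · have hn0 : n ≠ 0 := by
      rintro rfl
      exact hX.not_gt (by simpa using hc.1)
    unfold divSum
    refine Finset.sum_le_sum_of_subset_of_nonneg ?_ fun _ _ _ => Nat.cast_nonneg _
    intro m hm
    obtain ⟨hmn, hmM, hmΩ⟩ := Finset.mem_filter.1 hm
    have hd := (Nat.mem_divisors.1 hmn).1
    have hdz : (m : ℤ) ∣ (n : ℤ) := Int.natCast_dvd_natCast.2 hd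
    refine Finset.mem_filter.2 ⟨Finset.mem_filter.2 ⟨Finset.mem_Icc.2
      ⟨Nat.pos_of_dvd_of_pos hd (Nat.pos_of_ne_zero hn0), Nat.le_floor hmM⟩, hmΩ, ?_⟩, hdz⟩
    obtain ⟨s, hs⟩ := hn.symm.dvd
    have heq : (n : ℤ) = a + q * s := by linarith
    rw [heq] at hdz
    exact Nat.isCoprime_iff_coprime.1 (isCoprime_of_dvd_progression h hdz)
  · exact divSum_nonneg _ (fun _ => Nat.cast_nonneg _) _

lemma dTildeSum_le {k : ℕ} {ε' X x H : ℝ} {a : ℤ} {q : ℕ} (h : IsCoprime a (q : ℤ)) (hq : 1 ≤ q)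
    (hX : 0 ≤ X) (hx : 0 ≤ x) (hH : 0 ≤ H) :
    dTildeSum k ε' X x H a q ≤ ∑ i ∈ range (⌊H / q⌋₊ + 1),
      divSum (majorantSupport k ε' X q) (fun m => divisorCount (k - 1) m)
        (a + q * (⌈(x - a) / q⌉ + (i : ℕ))) := by
  have hq0 : (0 : ℝ) < q := by exact_mod_cast hq
  have hqz : (0 : ℤ) < q := by exact_mod_cast hq
  set W := divSum (majorantSupport k ε' X q) (fun m => divisorCount (k - 1) m) with hW
  have hWn : ∀ z, 0 ≤ W z := divSum_nonneg _ fun _ => Nat.cast_nonneg _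
  set t := ⌈(x - a) / q⌉ with ht
  unfold dTildeSum
  set P := (Finset.Icc ⌈x⌉₊ ⌊x + H⌋₊).filter (fun n : ℕ => (n : ℤ) ≡ a [ZMOD (q : ℤ)]) with hP
  let e : ℕ → ℕ := fun n => (((n : ℤ) - a) / q - t).toNat
  have key : ∀ n ∈ P, (n : ℤ) = a + q * (t + (e n : ℕ)) ∧ e n < ⌊H / q⌋₊ + 1 := by
    intro n hn
    obtain ⟨h1, h2⟩ := Finset.mem_filter.1 hn
    obtain ⟨h3, h4⟩ := Finset.mem_Icc.1 h1
    have h3' : x ≤ n := (Nat.le_ceil x).trans (by exact_mod_cast h3)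
    have h4' : (n : ℝ) ≤ x + H := (Nat.le_floor_iff (by linarith)).1 h4
    obtain ⟨s, hs⟩ := h2.symm.dvd
    have hdiv : ((n : ℤ) - a) / q = s := by
      rw [hs, Int.mul_ediv_cancel_left _ hqz.ne']
    have hsr : (n : ℝ) - a = q * s := by exact_mod_cast hs
    have hts : t ≤ s := by
      rw [ht, Int.ceil_le, div_le_iff₀ hq0]
      linarith
    have he : ((e n : ℕ) : ℤ) = s - t := by
      change (((((n : ℤ) - a) / q - t).toNat : ℕ) : ℤ) = s - t
      rw [hdiv, Int.toNat_of_nonneg (by omega)]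
    refine ⟨by rw [he]; linarith, ?_⟩
    rw [Nat.lt_succ_iff]
    apply Nat.le_floor
    have he' : ((e n : ℕ) : ℝ) = s - t := by exact_mod_cast he
    have htc : (x - a) / q ≤ t := Int.le_ceil _
    rw [div_le_iff₀ hq0] at htc
    rw [he', le_div_iff₀ hq0]
    linarith
  calc ∑ n ∈ P, dTilde k ε' X n ≤ ∑ n ∈ P, W (a + q * (t + (e n : ℕ))) := by
        refine Finset.sum_le_sum fun n hn => ?_
        rw [← (key n hn).1]
        exact dTilde_le_divSum h (Finset.mem_filter.1 hn).2 hX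
    _ = ∑ i ∈ P.image e, W (a + q * (t + (i : ℕ))) := by
        rw [Finset.sum_image]
        intro n hn n' hn' heq
        have h1 := (key n hn).1
        have h2 := (key n' hn').1
        rw [heq, ← h2] at h1
        exact_mod_cast h1
    _ ≤ _ := by
        refine Finset.sum_le_sum_of_subset_of_nonneg ?_ fun _ _ _ => hWn _
        intro i hi
        obtain ⟨n, hn, rfl⟩ := Finset.mem_image.1 hi
        exact Finset.mem_range.2 (key n hn).2

/-- Each place `t` of the progression corresponds to real numbers `x` of measure `q`. -/
lemma exists_exceptional_set {k : ℕ} {ε' X H T c : ℝ} {a : ℤ} {q : ℕ} (h : IsCoprime a (q : ℤ))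
    (hq : 1 ≤ q) (hX : 0 ≤ X) (hH : 0 ≤ H)
    (hc : ∀ U : ℤ, (#{t ∈ Ico U (U + (⌊3 * X / 2 / q⌋₊ + 2 : ℕ)) |
      T < ∑ i ∈ range (⌊H / q⌋₊ + 1), divSum (majorantSupport k ε' X q)
        (fun m => divisorCount (k - 1) m) (a + q * (t + i))} : ℝ) * q ≤ c) :
    ∃ E : Set ℝ, MeasurableSet E ∧ E ⊆ Set.Icc (X / 2) (2 * X) ∧
      MeasureTheory.volume E ≤ ENNReal.ofReal c ∧
      ∀ x ∈ Set.Icc (X / 2) (2 * X) \ E, dTildeSum k ε' X x H a q ≤ T := by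
  have hq0 : (0 : ℝ) < q := by exact_mod_cast hq
  set U : ℤ := ⌈(X / 2 - a) / q⌉ with hU
  set B := {t ∈ Ico U (U + (⌊3 * X / 2 / q⌋₊ + 2 : ℕ)) |
      T < ∑ i ∈ range (⌊H / q⌋₊ + 1), divSum (majorantSupport k ε' X q)
        (fun m => divisorCount (k - 1) m) (a + q * (t + i))} with hB
  let τ : ℝ → ℤ := fun x => ⌈(x - a) / q⌉
  have hτ : Measurable τ := Int.measurable_ceil.comp (by fun_prop)
  refine ⟨Set.Icc (X / 2) (2 * X) ∩ τ ⁻¹' (B : Set ℤ), measurableSet_Icc.inter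
    (hτ (Set.to_countable _).measurableSet), Set.inter_subset_left, ?_, ?_⟩
  · have hsub : Set.Icc (X / 2) (2 * X) ∩ τ ⁻¹' (B : Set ℤ) ⊆
        ⋃ t ∈ B, Set.Ioc (q * ((t : ℝ) - 1) + a) (q * (t : ℝ) + a) := by
      rintro x ⟨-, hx⟩
      refine Set.mem_iUnion₂.2 ⟨τ x, hx, ?_⟩
      have h1 : (x - a) / q ≤ τ x := Int.le_ceil _
      have h2 : (τ x : ℝ) < (x - a) / q + 1 := Int.ceil_lt_add_one _
      have h3 : (τ x : ℝ) - 1 < (x - a) / q := by linarith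
      rw [div_le_iff₀ hq0] at h1
      rw [lt_div_iff₀ hq0] at h3
      constructor <;> linarith
    refine (MeasureTheory.measure_mono hsub).trans
      ((MeasureTheory.measure_biUnion_finset_le _ _).trans ?_)
    have hv : ∀ t ∈ B, MeasureTheory.volume
        (Set.Ioc (q * ((t : ℝ) - 1) + a) (q * (t : ℝ) + a)) = ENNReal.ofReal q := by
      intro t _
      rw [Real.volume_Ioc]
      congr 1
      ring
    rw [Finset.sum_congr rfl hv, Finset.sum_const, nsmul_eq_mul, ← ENNReal.ofReal_natCast,
      ← ENNReal.ofReal_mul (Nat.cast_nonneg _)]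
    exact ENNReal.ofReal_le_ofReal (hc U)
  · rintro x ⟨hx, hxE⟩
    have hx0 : 0 ≤ x := by linarith [hx.1]
    have hxB : τ x ∉ B := fun hb => hxE ⟨hx, hb⟩
    refine (dTildeSum_le h hq hX hx0 hH).trans ?_
    by_contra! hlt
    refine hxB (Finset.mem_filter.2 ⟨Finset.mem_Ico.2 ⟨?_, ?_⟩, hlt⟩)
    · refine Int.ceil_mono ?_
      gcongr
      exact hx.1
    · have h1 : (τ x : ℝ) < (x - a) / q + 1 := Int.ceil_lt_add_one _
      have h2 : (X / 2 - a) / q ≤ (U : ℝ) := Int.le_ceil _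
      have h3 : 3 * X / 2 / q < (⌊3 * X / 2 / q⌋₊ : ℝ) + 1 := Nat.lt_floor_add_one _
      have h4 : (x - a) / q ≤ (X / 2 - a) / q + 3 * X / 2 / q := by
        rw [← add_div]
        gcongr
        linarith [hx.2]
      have h5 : (τ x : ℝ) < U + (⌊3 * X / 2 / q⌋₊ + 2 : ℕ) := by push_cast; linarith
      exact_mod_cast h5

/-! ### Choice of parameters -/

/-- The conclusion of the theorem at a given `X`, with constant `C` and with exponent
`k - 1 + η` of `log X` in the bound for the sum. -/
def MajorantBound (k : ℕ) (C η X : ℝ) : Prop :=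
  ∀ (ε' H₁ : ℝ) (q : ℕ) (a : ℤ), 0 < ε' → H₁ ≤ X →
    (Real.log X) ^ ((1 + 2 * ε') * k * Real.log k) ≤ H₁ → 1 ≤ q →
    (q : ℝ) ≤ min (H₁ / (Real.log X) ^ ((1 + 2 * ε') * k * Real.log k))
      ((Real.log X) ^ (10000 * (k : ℝ) ^ 10)) →
    IsCoprime a (q : ℤ) →
    ∃ E : Set ℝ, MeasurableSet E ∧ E ⊆ Set.Icc (X / 2) (2 * X) ∧
      MeasureTheory.volume E ≤ ENNReal.ofReal
        (C * (X * (Real.log X) ^ (-(10000 * (k : ℝ) ^ 10)) +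
          X * ((Real.log X) ^ (3 * (1 + ε') * k * Real.log k + 7) / (H₁ / q) ^ 2))) ∧
      ∀ x ∈ Set.Icc (X / 2) (2 * X) \ E,
        dTildeSum k ε' X x H₁ a q ≤ C * (H₁ / q) * (Real.log X) ^ ((k : ℝ) - 1 + η)

/-- The inequalities, valid for large `X`, that the argument needs for tuples of length `r`, when
`(log X) ^ (-A)` is to be saved and `(log X) ^ B` separates short from long intervals. -/
structure LargeParameter (k r : ℕ) (A B η X : ℝ) : Prop where
  one_le_log : 1 ≤ Real.log X
  log_loglog : 0 < Real.log (Real.log X)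
  log_trunc : 1 + 3 * Real.log (truncLevel k X) ≤ Real.log X
  one_le_trunc : 1 ≤ truncLevel k X
  trunc_pow : 4 * truncLevel k X ^ r ≤ X ^ (1 / 2 : ℝ)
  log_pow : 4 * ((Real.log X) ^ A) ^ 2 ≤ X ^ (1 / 2 : ℝ)
  four_le : 4 ≤ (Real.log X) ^ η
  cube_le : 32 * (r : ℝ) ^ 3 ≤ (Real.log X) ^ 2
  smooth_part : 2 * 4 ^ r *
    (r ^ 2 * (2 * ((B + 1) * Real.log (Real.log X))) + 1) ^ (k ^ r) ≤ Real.log X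

open Filter Topology in
lemma eventually_largeParameter (k r : ℕ) (A : ℝ) {B η : ℝ} (hη : 0 < η) (hB : 0 ≤ B) :
    ∀ᶠ X in atTop, LargeParameter k r A B η X := by
  have hl : Tendsto Real.log atTop atTop := Real.tendsto_log_atTop
  have hll : Tendsto (fun X => Real.log (Real.log X)) atTop atTop := hl.comp hl
  have hlogpow : Tendsto (fun X : ℝ => Real.log X ^ (2 * A) / X ^ (1 / 2 : ℝ)) atTop (𝓝 0) :=
    (isLittleO_log_rpow_rpow_atTop (2 * A) (by norm_num : (0 : ℝ) < 1 / 2)).tendsto_div_nhds_zero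
  have hsm : ∀ᶠ L : ℝ in atTop, 2 * 4 ^ r *
      (r ^ 2 * (2 * ((B + 1) * L)) + 1) ^ (k ^ r) ≤ Real.exp L := by
    have h1 : ∀ᶠ L : ℝ in atTop, 2 * 4 ^ r * (r ^ 2 * (2 * (B + 1)) + 1) ^ (k ^ r) *
        L ^ (k ^ r) ≤ Real.exp L := by
      have h2 := (Real.isLittleO_pow_exp_atTop (n := k ^ r)).const_mul_left
        (2 * 4 ^ r * (r ^ 2 * (2 * (B + 1)) + 1) ^ (k ^ r))
      filter_upwards [h2.bound one_pos] with L hL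
      rw [one_mul, Real.norm_eq_abs, Real.norm_eq_abs, Real.abs_exp] at hL
      exact (le_abs_self _).trans hL
    filter_upwards [h1, eventually_ge_atTop 1] with L hL hL1
    refine le_trans ?_ hL
    have h2 : (r : ℝ) ^ 2 * (2 * ((B + 1) * L)) + 1 ≤ (r ^ 2 * (2 * (B + 1)) + 1) * L := by
      linarith
    calc _ ≤ 2 * 4 ^ r * ((r ^ 2 * (2 * (B + 1)) + 1) * L) ^ (k ^ r) := by gcongr
      _ = _ := by rw [mul_pow]; ring
  filter_upwards [hl.eventually_ge_atTop 2, hll.eventually_ge_atTop 1,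
    hll.eventually_ge_atTop (12 * k), hll.eventually_ge_atTop (8 * k * r),
    eventually_gt_atTop 0,
    hlogpow.eventually (gt_mem_nhds (by norm_num : (0 : ℝ) < 1 / 4)),
    (tendsto_rpow_atTop (by norm_num : (0 : ℝ) < 1 / 4)).eventually_ge_atTop 4,
    ((tendsto_rpow_atTop hη).comp hl).eventually_ge_atTop 4,
    ((tendsto_pow_atTop (two_ne_zero)).comp hl).eventually_ge_atTop (32 * (r : ℝ) ^ 3),
    hll.eventually hsm] with X h1 h2 h3 h4 h5 h6 h7 h8 h9 h10
  have hL0 : 0 < Real.log (Real.log X) := by linarith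
  have hX1 : 1 ≤ X := by
    by_contra! hlt
    have := Real.log_nonpos h5.le hlt.le
    linarith
  have hlogtr : Real.log (truncLevel k X) =
      2 * (k : ℝ) / Real.log (Real.log X) * Real.log X := by
    rw [truncLevel, Real.log_rpow h5]
  refine ⟨by linarith, hL0, ?_, ?_, ?_, ?_, h8, h9, ?_⟩
  · rw [hlogtr]
    have h11 : 2 * (k : ℝ) / Real.log (Real.log X) ≤ 1 / 6 := by
      rw [div_le_iff₀ hL0]; linarith
    nlinarith
  · exact Real.one_le_rpow hX1 (by positivity)
  · have h11 : truncLevel k X ^ r ≤ X ^ (1 / 4 : ℝ) := by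
      rw [truncLevel, ← Real.rpow_natCast, ← Real.rpow_mul h5.le]
      refine Real.rpow_le_rpow_of_exponent_le hX1 ?_
      rw [div_mul_eq_mul_div, div_le_iff₀ hL0]
      linarith
    have h12 : X ^ (1 / 2 : ℝ) = X ^ (1 / 4 : ℝ) * X ^ (1 / 4 : ℝ) := by
      rw [← Real.rpow_add h5]; norm_num
    rw [h12]
    exact mul_le_mul h7 h11 (by unfold truncLevel; positivity) (by positivity)
  · rw [div_lt_iff₀ (by positivity)] at h6
    have h11 : (Real.log X ^ A) ^ 2 = Real.log X ^ (2 * A) := by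
      rw [← Real.rpow_natCast, ← Real.rpow_mul (by linarith)]
      norm_num [mul_comm]
    rw [h11]
    linarith
  · rw [Real.exp_log (by linarith)] at h10
    exact h10

lemma log_floor_truncLevel_le {k : ℕ} {X : ℝ} (h1 : 1 ≤ truncLevel k X) :
    Real.log ⌊truncLevel k X⌋₊ ≤ Real.log (truncLevel k X) := by
  refine Real.log_le_log ?_ (Nat.floor_le (by linarith))
  exact_mod_cast Nat.floor_pos.2 h1

lemma divisorCount_le_of_mem_majorantSupport {k : ℕ} (hk : 1 ≤ k) {ε' X : ℝ} {q m : ℕ}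
    (hl : 0 < Real.log X) (hm : m ∈ majorantSupport k ε' X q) :
    (divisorCount (k - 1) m : ℝ) ≤ Real.log X ^ ((1 + ε') * k * Real.log k) := by
  obtain ⟨h1, h2, -⟩ := Finset.mem_filter.1 hm
  have hm0 : m ≠ 0 := by have := Finset.mem_Icc.1 h1; omega
  have hk0 : (0 : ℝ) < k := by exact_mod_cast hk
  have hk1 : (1 : ℝ) ≤ k := by exact_mod_cast hk
  calc (divisorCount (k - 1) m : ℝ)
      ≤ ((k - 1 : ℕ) : ℝ) ^ ArithmeticFunction.cardFactors m := by
        exact_mod_cast divisorCount_le_pow_cardFactors (k - 1) m hm0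
    _ ≤ (k : ℝ) ^ ArithmeticFunction.cardFactors m := by
        gcongr; exact Nat.sub_le k 1
    _ ≤ (k : ℝ) ^ ((1 + ε') * k * Real.log (Real.log X)) := by
        rw [← Real.rpow_natCast]
        exact Real.rpow_le_rpow_of_exponent_le hk1 h2
    _ = _ := by
        rw [Real.rpow_def_of_pos hk0, Real.rpow_def_of_pos hl]
        congr 1
        ring

/-- The exceptional places for long intervals, `h ≥ ℓ ^ (A + k ^ 2)` with `ℓ = log X`: the variance
loses at most `ℓ ^ (k ^ 2)`, so this length saves `ℓ ^ A`. -/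
lemma card_exceptional_le_long {k r : ℕ} {A B η X ε' h T : ℝ} {a : ℤ} {q R : ℕ}
    (hX : LargeParameter k r A B η X) (hr : 3 ≤ r) (hk : 1 ≤ k) (haq : IsCoprime a (q : ℤ))
    (hRA : 4 * (truncLevel k X) ^ r * Real.log X ^ A ≤ R) (hh1 : 1 ≤ h)
    (hh : Real.log X ^ (A + k ^ 2) ≤ h) (hT : T = h * Real.log X ^ ((k : ℝ) - 1 + η)) (U : ℤ) :
    (#{t ∈ Ico U (U + R) | T < ∑ i ∈ range (⌊h⌋₊ + 1), divSum (majorantSupport k ε' X q)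
        (fun m => divisorCount (k - 1) m) (a + q * (t + i))} : ℝ) ≤
      2 * R * Real.log X ^ (-A) := by
  have hl1 := hX.one_le_log
  have hl0 : 0 < Real.log X := by linarith
  have hM1 := hX.one_le_trunc
  have hMlog := log_floor_truncLevel_le hM1
  have hM0 : 0 ≤ Real.log ⌊truncLevel k X⌋₊ := Real.log_natCast_nonneg _
  have htr := hX.log_trunc
  have hcast : ((k - 1 : ℕ) : ℝ) = (k : ℝ) - 1 := by rw [Nat.cast_sub hk, Nat.cast_one]
  have hfl : (⌊h⌋₊ : ℝ) ≤ h := Nat.floor_le (by linarith)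
  have hlt : h < (⌊h⌋₊ : ℝ) + 1 := Nat.lt_floor_add_one h
  have hAp : 0 < Real.log X ^ A := Real.rpow_pos_of_pos hl0 _
  have hτ1 : (1 : ℝ) ≤ Real.log X ^ (k - 1) := one_le_pow₀ hl1
  refine (card_exceptional_le_of_variance haq (Finset.filter_subset _ _)
    (fun m hm => (Finset.mem_filter.1 hm).2.2) (k - 1) U (⌊h⌋₊ + 1)
    (τ := Real.log X ^ (k - 1)) ?_ (by positivity) (Nat.succ_pos _) ?_).trans ?_
  · exact pow_le_pow_left₀ (by linarith) (by linarith) _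
  · rw [hT, Real.rpow_add hl0, ← hcast, Real.rpow_natCast]
    push_cast
    have h4 := hX.four_le
    calc 2 * ((⌊h⌋₊ : ℝ) + 1) * Real.log X ^ (k - 1)
        ≤ (h * 4) * Real.log X ^ (k - 1) :=
          mul_le_mul_of_nonneg_right (by linarith) (by positivity)
      _ ≤ (h * Real.log X ^ η) * Real.log X ^ (k - 1) := by gcongr
      _ = _ := by ring
  · have e1 : (R : ℝ) * (1 + 2 * Real.log ⌊truncLevel k X⌋₊) ^ ((k - 1 + 1) ^ 2) /
        ((⌊h⌋₊ + 1 : ℕ) * (Real.log X ^ (k - 1)) ^ 2) ≤ R * Real.log X ^ (-A) := by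
      rw [mul_div_assoc]
      refine mul_le_mul_of_nonneg_left ?_ (Nat.cast_nonneg _)
      rw [Nat.sub_add_cancel hk, div_le_iff₀ (by positivity)]
      calc (1 + 2 * Real.log ⌊truncLevel k X⌋₊) ^ (k ^ 2)
          ≤ Real.log X ^ (k ^ 2) := by gcongr; linarith
        _ = Real.log X ^ (-A) * Real.log X ^ (A + k ^ 2) := by
            rw [← Real.rpow_add hl0, ← Real.rpow_natCast]; push_cast; ring_nf
        _ ≤ Real.log X ^ (-A) * ((⌊h⌋₊ + 1 : ℕ) * (Real.log X ^ (k - 1)) ^ 2) := by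
            gcongr
            push_cast
            nlinarith [one_le_pow₀ hτ1 (n := 2)]
    have e2 : 4 * (⌊truncLevel k X⌋₊ : ℝ) ^ 2 ≤ R * Real.log X ^ (-A) := by
      rw [Real.rpow_neg hl0.le, ← div_eq_mul_inv, le_div_iff₀ hAp]
      refine le_trans ?_ hRA
      gcongr
      calc (⌊truncLevel k X⌋₊ : ℝ) ^ 2 ≤ truncLevel k X ^ 2 := by
            gcongr; exact Nat.floor_le (by linarith)
        _ ≤ truncLevel k X ^ r := pow_le_pow_right₀ hM1 (by omega)
    linarith

/-- The exceptional places for short intervals, `h ≤ ℓ ^ B` with `ℓ = log X`. The tuple length `r` is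
such that exceeding the mean by `ℓ ^ η` saves `ℓ ^ (A + 1)` in the `r`-th moment. -/
lemma card_exceptional_le_short {k r : ℕ} {A B η X ε' h T : ℝ} {a : ℤ} {q R : ℕ}
    (hX : LargeParameter k r A B η X) (hr : 3 ≤ r) (hk : 2 ≤ k) (haq : IsCoprime a (q : ℤ))
    (hη : 0 < η) (hηr : A + 1 ≤ η * r)
    (hR : truncLevel k X ^ r ≤ R) (hh1 : 1 ≤ h)
    (hh : h ≤ Real.log X ^ B) (hT : T = h * Real.log X ^ ((k : ℝ) - 1 + η)) (U : ℤ) :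
    (#{t ∈ Ico U (U + R) | T < ∑ i ∈ range (⌊h⌋₊ + 1), divSum (majorantSupport k ε' X q)
        (fun m => divisorCount (k - 1) m) (a + q * (t + i))} : ℝ) ≤
      R * (Real.log X ^ (-A) + Real.log X ^ (3 * (1 + ε') * k * Real.log k + 7) / h ^ 2) := by
  have hl1 := hX.one_le_log
  have hl0 : 0 < Real.log X := by linarith
  have hL0 := hX.log_loglog
  have hM1 := hX.one_le_trunc
  have hMlog := log_floor_truncLevel_le hM1
  have hM0 : 0 ≤ Real.log ⌊truncLevel k X⌋₊ := Real.log_natCast_nonneg _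
  have htr := hX.log_trunc
  have hfl : (⌊h⌋₊ : ℝ) ≤ h := Nat.floor_le (by linarith)
  have hN2 : ((⌊h⌋₊ + 1 : ℕ) : ℝ) ≤ 2 * h := by push_cast; linarith
  have hcast : ((k - 1 : ℕ) : ℝ) = (k : ℝ) - 1 := by rw [Nat.cast_sub (by omega), Nat.cast_one]
  -- a spare factor `log X` absorbs the constant in `⌊h⌋ + 1 ≤ 2 h`
  have hl2 : 2 ≤ Real.log X := by
    have h3 : (3 : ℝ) ≤ r := by exact_mod_cast hr
    by_contra! hlt
    have := hX.cube_le
    have h4 : (3 : ℝ) ^ 3 ≤ (r : ℝ) ^ 3 := by gcongr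
    nlinarith
  set M := ⌊truncLevel k X⌋₊ with hM
  set Q := Real.log X ^ ((1 + ε') * k * Real.log k) with hQ
  have hQ0 : 0 ≤ Q := by positivity
  have hMpow : M ^ r ≤ R := by
    have : (M : ℝ) ^ r ≤ R := (pow_le_pow_left₀ (Nat.cast_nonneg _)
      (Nat.floor_le (by linarith)) r).trans hR
    exact_mod_cast this
  have hMpos : 0 < M := Nat.floor_pos.2 hM1
  have hM3 : M ^ 3 ≤ R := (Nat.pow_le_pow_right hMpos hr).trans hMpow
  have hTη : T = h * (Real.log X ^ (k - 1) * Real.log X ^ η) := by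
    rw [hT, Real.rpow_add hl0, ← hcast, Real.rpow_natCast]
  have hη1 : 1 ≤ Real.log X ^ η := Real.one_le_rpow hl1 hη.le
  have hT0 : 0 < T := by rw [hT]; positivity
  refine (card_exceptional_le haq (Finset.filter_subset _ _) (Q := Q) (k := k - 1)
    (fun _ => Nat.cast_nonneg _)
    (fun m hm => divisorCount_le_of_mem_majorantSupport (by omega) hl0 hm)
    (fun _ _ => le_rfl) hQ0 (by omega) hM3 hMpow U (⌊h⌋₊ + 1) hT0).trans ?_
  rw [mul_add, add_comm]
  refine add_le_add ?_ ?_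
  -- the contribution of tuples of distinct terms: the factor `4 ^ r` and the one from the small
  -- primes are absorbed by one power of `log X`
  · have hlogN : (Nat.log 2 (⌊h⌋₊ + 1) : ℝ) ≤ 2 * ((B + 1) * Real.log (Real.log X)) := by
      have h1 : (2 : ℝ) ^ Nat.log 2 (⌊h⌋₊ + 1) ≤ Real.log X ^ (B + 1) := by
        calc (2 : ℝ) ^ Nat.log 2 (⌊h⌋₊ + 1) ≤ ((⌊h⌋₊ + 1 : ℕ) : ℝ) := by
              exact_mod_cast Nat.pow_log_le_self 2 (Nat.succ_ne_zero _)
          _ ≤ 2 * h := hN2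
          _ ≤ Real.log X * Real.log X ^ B := by gcongr
          _ = _ := by rw [Real.rpow_add hl0, Real.rpow_one, mul_comm]
      have h2 := Real.log_le_log (by positivity) h1
      rw [Real.log_pow, Real.log_rpow hl0] at h2
      have h3 : (1 / 2 : ℝ) ≤ Real.log 2 := by have := Real.log_two_gt_d9; linarith
      have h4 : (Nat.log 2 (⌊h⌋₊ + 1) : ℝ) * (1 / 2) ≤ Nat.log 2 (⌊h⌋₊ + 1) * Real.log 2 := by
        gcongr
      linarith
    have hsm : 2 * 4 ^ r * ((r ^ 2 * Nat.log 2 (⌊h⌋₊ + 1) : ℕ) + 1 : ℝ) ^ ((k - 1 + 1) ^ r) ≤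
        Real.log X := by
      rw [Nat.sub_add_cancel (by omega : 1 ≤ k)]
      refine le_trans ?_ hX.smooth_part
      push_cast
      gcongr
    have hmean : (1 + Real.log M) ^ (k - 1) ≤ Real.log X ^ (k - 1) := by
      gcongr; linarith
    have hηA : Real.log X ≤ Real.log X ^ (-A) * (Real.log X ^ η) ^ r := by
      rw [← Real.rpow_natCast, ← Real.rpow_mul hl0.le, ← Real.rpow_add hl0]
      calc Real.log X = Real.log X ^ (1 : ℝ) := (Real.rpow_one _).symm
        _ ≤ _ := Real.rpow_le_rpow_of_exponent_le hl1 (by linarith)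
    rw [div_le_iff₀ (by positivity)]
    set Y := ((r ^ 2 * Nat.log 2 (⌊h⌋₊ + 1) : ℕ) + 1 : ℝ) ^ ((k - 1 + 1) ^ r) with hY
    have hY0 : 0 ≤ Y := by positivity
    calc ((⌊h⌋₊ + 1 : ℕ) : ℝ) ^ r * (2 * R * ((1 + Real.log M) ^ (k - 1)) ^ r * Y)
        ≤ (2 * h) ^ r * (2 * R * (Real.log X ^ (k - 1)) ^ r * Y) := by gcongr
      _ = R * (2 * 4 ^ r * Y) * (h * Real.log X ^ (k - 1) / 2) ^ r := by
          have : (4 : ℝ) ^ r = 2 ^ r * 2 ^ r := by rw [← mul_pow]; norm_num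
          rw [this, div_pow, mul_pow, mul_pow]
          field_simp
      _ ≤ R * (Real.log X ^ (-A) * (Real.log X ^ η) ^ r) *
          (h * Real.log X ^ (k - 1) / 2) ^ r := by
          exact mul_le_mul_of_nonneg_right (mul_le_mul_of_nonneg_left (hsm.trans hηA)
            (Nat.cast_nonneg _)) (by positivity)
      _ = R * Real.log X ^ (-A) * (T / 2) ^ r := by
          have hT2 : T / 2 = Real.log X ^ η * (h * Real.log X ^ (k - 1) / 2) := by
            rw [hTη]; ring
          rw [hT2, mul_pow (Real.log X ^ η)]
          ring
  -- the contribution of a single large term: `k ≥ 2` gives a spare factor `(log X) ^ 3`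
  · have hQ3 : Real.log X ^ (3 * (1 + ε') * k * Real.log k + 7) = Q ^ 3 * Real.log X ^ 7 := by
      rw [Real.rpow_add hl0, hQ, ← Real.rpow_natCast (_ ^ _), ← Real.rpow_mul hl0.le]
      congr 1
      · congr 1; push_cast; ring
      · exact_mod_cast Real.rpow_natCast (Real.log X) 7
    have hTl : h * Real.log X ≤ T := by
      rw [hTη]
      have : Real.log X ≤ Real.log X ^ (k - 1) := le_self_pow₀ hl1 (by omega)
      gcongr
      calc Real.log X = Real.log X * 1 := (mul_one _).symm
        _ ≤ _ := by gcongr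
    have hr0 : (0 : ℝ) < r := by exact_mod_cast (by omega : 0 < r)
    calc _ ≤ (2 * h) * (Q ^ 3 * (2 * R * Real.log X ^ 8)) / (h * Real.log X / (2 * r)) ^ 3 := by
          gcongr
          linarith
      _ = R * (Q ^ 3 * (Real.log X ^ 5 * (32 * r ^ 3)) / h ^ 2) := by
          field_simp
          ring
      _ ≤ R * (Q ^ 3 * (Real.log X ^ 5 * Real.log X ^ 2) / h ^ 2) := by
          gcongr
          exact hX.cube_le
      _ = _ := by rw [hQ3]; ring

/-- For `k = 1` the majorant is at most `1`. -/
lemma card_exceptional_eq_zero {ε' X h T : ℝ} {a : ℤ} {q R : ℕ} (hh : 1 ≤ h) (hT : 2 * h ≤ T)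
    (U : ℤ) :
    (#{t ∈ Ico U (U + R) | T < ∑ i ∈ range (⌊h⌋₊ + 1), divSum (majorantSupport 1 ε' X q)
        (fun m => divisorCount (1 - 1) m) (a + q * (t + i))} : ℝ) = 0 := by
  rw [Nat.cast_eq_zero, Finset.card_eq_zero, Finset.filter_eq_empty_iff]
  intro t _
  rw [not_lt]
  have hfl : (⌊h⌋₊ : ℝ) ≤ h := Nat.floor_le (by linarith)
  calc _ ≤ ∑ _i ∈ range (⌊h⌋₊ + 1), (1 : ℝ) := by
        refine Finset.sum_le_sum fun i _ => ?_
        unfold divSum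
        simp only [Nat.sub_self, divisorCount_zero_left, Nat.cast_ite, Nat.cast_one, Nat.cast_zero]
        rw [Finset.sum_ite_eq']
        split_ifs <;> norm_num
    _ ≤ T := by simp; linarith

lemma majorantBound_of_largeParameter {k r : ℕ} {η X : ℝ} (hk : 1 ≤ k) (hr : 3 ≤ r) (hη : 0 < η)
    (hηr : 10000 * (k : ℝ) ^ 10 + 1 ≤ η * r)
    (hX : LargeParameter k r (10000 * (k : ℝ) ^ 10) (10000 * (k : ℝ) ^ 10 + k ^ 2) η X)
    (hX0 : 0 < X) : MajorantBound k 4 η X := by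
  intro ε' H₁ q a hε _ hlow hq hqle haq
  have hA0 : 0 ≤ 10000 * (k : ℝ) ^ 10 := by positivity
  generalize 10000 * (k : ℝ) ^ 10 = A at *
  have hl1 := hX.one_le_log
  have hl0 : 0 < Real.log X := by linarith
  have hq0 : (0 : ℝ) < q := by exact_mod_cast hq
  have hk1 : (1 : ℝ) ≤ k := by exact_mod_cast hk
  have hlogk : 0 ≤ Real.log k := Real.log_nonneg hk1
  have hlowpos : 1 ≤ Real.log X ^ ((1 + 2 * ε') * k * Real.log k) :=
    Real.one_le_rpow hl1 (by positivity)
  obtain ⟨hq1, hqA⟩ := le_min_iff.1 hqle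
  have hqH : (q : ℝ) ≤ H₁ := hq1.trans (div_le_self (by linarith) hlowpos)
  have hh1 : 1 ≤ H₁ / q := (one_le_div hq0).2 hqH
  have hAp : 1 ≤ Real.log X ^ A := Real.one_le_rpow hl1 (by positivity)
  -- `R` consecutive places `t` cover all `x ∈ [X / 2, 2 X]`; as `q ≤ (log X) ^ A`, this number
  -- exceeds every product of `r` divisors `m ≤ M`
  obtain ⟨R, hR⟩ : ∃ R : ℕ, R = ⌊3 * X / 2 / q⌋₊ + 2 := ⟨_, rfl⟩
  have hsq : X ^ (1 / 2 : ℝ) * X ^ (1 / 2 : ℝ) = X := by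
    rw [← Real.rpow_add hX0]; norm_num
  have hXA : 4 * (Real.log X ^ A) ^ 2 ≤ X ^ (1 / 2 : ℝ) := hX.log_pow
  have hA2 : Real.log X ^ A ≤ (Real.log X ^ A) ^ 2 := le_self_pow₀ hAp two_ne_zero
  have hs1 : 1 ≤ X ^ (1 / 2 : ℝ) := by linarith
  have hXq : 4 * (q : ℝ) ≤ X := by
    have := mul_le_mul_of_nonneg_left hs1 (by linarith : 0 ≤ X ^ (1 / 2 : ℝ))
    linarith
  have hR1 : X / q ≤ R := by
    have h3 : 3 * X / 2 / q < (⌊3 * X / 2 / q⌋₊ : ℝ) + 1 := Nat.lt_floor_add_one _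
    have h4 : X / q ≤ 3 * X / 2 / q := by gcongr; linarith
    rw [hR]; push_cast; linarith
  have hR2 : (R : ℝ) * q ≤ 2 * X := by
    have h3 : (⌊3 * X / 2 / q⌋₊ : ℝ) ≤ 3 * X / 2 / q := Nat.floor_le (by positivity)
    rw [le_div_iff₀ hq0] at h3
    rw [hR]; push_cast; linarith
  have hR3 : X ^ (1 / 2 : ℝ) * Real.log X ^ A ≤ R := by
    refine le_trans ?_ hR1
    rw [le_div_iff₀ hq0]
    calc X ^ (1 / 2 : ℝ) * Real.log X ^ A * q
        ≤ X ^ (1 / 2 : ℝ) * Real.log X ^ A * Real.log X ^ A := by gcongr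
      _ = X ^ (1 / 2 : ℝ) * (Real.log X ^ A) ^ 2 := by ring
      _ ≤ X ^ (1 / 2 : ℝ) * X ^ (1 / 2 : ℝ) := by gcongr; linarith
      _ = X := hsq
  have htr := hX.trunc_pow
  have htr0 : 0 ≤ truncLevel k X ^ r := pow_nonneg (by linarith [hX.one_le_trunc]) _
  have hRA : 4 * (truncLevel k X) ^ r * Real.log X ^ A ≤ R :=
    (mul_le_mul_of_nonneg_right htr (by linarith)).trans hR3
  have hRr : truncLevel k X ^ r ≤ R := by
    have := mul_le_mul_of_nonneg_left hAp htr0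
    linarith
  set h := H₁ / q with hh
  set T := h * Real.log X ^ ((k : ℝ) - 1 + η) with hT
  have hT0 : 0 ≤ T := by positivity
  set S := Real.log X ^ (3 * (1 + ε') * k * Real.log k + 7) / h ^ 2 with hS
  have hS0 : 0 ≤ S := by positivity
  have hm0 : 0 ≤ Real.log X ^ (-A) := by positivity
  have hcount : ∀ U : ℤ, (#{t ∈ Ico U (U + R) | T < ∑ i ∈ range (⌊h⌋₊ + 1),
      divSum (majorantSupport k ε' X q) (fun m => divisorCount (k - 1) m)
        (a + q * (t + i))} : ℝ) ≤ R * (2 * (Real.log X ^ (-A) + S)) := by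
    intro U
    have hRn : (0 : ℝ) ≤ R := Nat.cast_nonneg _
    rcases hk.eq_or_lt with rfl | hk2
    · rw [card_exceptional_eq_zero hh1 ?_ U]
      · positivity
      · rw [hT, Nat.cast_one, sub_self, zero_add]
        rw [mul_comm]
        exact mul_le_mul_of_nonneg_left (by linarith [hX.four_le]) (by linarith)
    · rcases le_total h (Real.log X ^ (A + (k : ℝ) ^ 2)) with hle | hle
      · refine (card_exceptional_le_short hX hr hk2 haq hη hηr hRr hh1 hle hT
          U).trans ?_
        gcongr
        linarith
      · refine (card_exceptional_le_long hX hr hk haq hRA hh1 hle hT U).trans ?_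
        linarith [mul_nonneg hRn hS0, mul_nonneg hRn hm0]
  obtain ⟨E, hE1, hE2, hE3, hE4⟩ := exists_exceptional_set (k := k) (ε' := ε') (X := X) (H := H₁)
    (T := T) (c := 4 * (X * Real.log X ^ (-A) + X * S)) haq hq hX0.le (by linarith) fun U => by
      rw [← hR]
      calc _ ≤ R * (2 * (Real.log X ^ (-A) + S)) * q :=
            mul_le_mul_of_nonneg_right (hcount U) hq0.le
        _ = (R * q) * (2 * (Real.log X ^ (-A) + S)) := by ring
        _ ≤ (2 * X) * (2 * (Real.log X ^ (-A) + S)) := by gcongr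
        _ = _ := by ring
  refine ⟨E, hE1, hE2, hE3, fun x hx => (hE4 x hx).trans ?_⟩
  rw [mul_assoc]
  linarith

open Filter Topology in
lemma eventually_majorantBound {k : ℕ} (hk : 1 ≤ k) {η : ℝ} (hη : 0 < η) :
    ∀ᶠ X in atTop, MajorantBound k 4 η X := by
  obtain ⟨r, hr⟩ := exists_nat_ge ((10000 * (k : ℝ) ^ 10 + 1) / η)
  have hηr : 10000 * (k : ℝ) ^ 10 + 1 ≤ η * (max r 3 : ℕ) := by
    rw [div_le_iff₀ hη] at hr
    have : (r : ℝ) ≤ (max r 3 : ℕ) := by exact_mod_cast le_max_left _ _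
    nlinarith
  filter_upwards [eventually_largeParameter k (max r 3) (10000 * (k : ℝ) ^ 10)
    (B := 10000 * (k : ℝ) ^ 10 + k ^ 2) hη (by positivity), eventually_gt_atTop 0] with X hX hX0
  exact majorantBound_of_largeParameter hk (le_max_right _ _) hη hηr hX hX0

lemma MajorantBound.mono {k : ℕ} {C C' η η' X : ℝ} (hX : 3 ≤ X) (h : MajorantBound k C η X)
    (hC : 0 ≤ C) (hCC : C ≤ C') (hη : η ≤ η') : MajorantBound k C' η' X := by
  intro ε' H₁ q a hε h1 h2 h3 h4 h5
  obtain ⟨E, hE1, hE2, hE3, hE4⟩ := h ε' H₁ q a hε h1 h2 h3 h4 h5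
  have hl1 : 1 ≤ Real.log X := by
    rw [Real.le_log_iff_exp_le (by linarith)]
    linarith [Real.exp_one_lt_d9]
  have hl0 : 0 < Real.log X := by linarith
  have hH : 0 ≤ H₁ := (Real.rpow_nonneg hl0.le _).trans h2
  refine ⟨E, hE1, hE2, hE3.trans (ENNReal.ofReal_le_ofReal ?_), fun x hx => (hE4 x hx).trans ?_⟩
  · gcongr
  · have : 0 ≤ C' := hC.trans hCC
    gcongr

/-- For bounded `X` the whole interval is an admissible exceptional set. -/
lemma majorantBound_of_large_constant {k : ℕ} {C η X : ℝ} (hX : 3 ≤ X)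
    (hC : 2 * Real.log X ^ (10000 * (k : ℝ) ^ 10) ≤ C) : MajorantBound k C η X := by
  intro ε' H₁ q a hε h1 h2 h3 h4 h5
  have hl0 : 0 < Real.log X := Real.log_pos (by linarith)
  have hC0 : 0 ≤ C := le_trans (by positivity) hC
  refine ⟨Set.Icc (X / 2) (2 * X), measurableSet_Icc, subset_rfl, ?_, fun x hx => by simp at hx⟩
  rw [Real.volume_Icc]
  refine ENNReal.ofReal_le_ofReal ?_
  have h6 : 0 ≤ X * ((Real.log X) ^ (3 * (1 + ε') * k * Real.log k + 7) / (H₁ / q) ^ 2) := by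
    positivity
  calc 2 * X - X / 2 ≤ 2 * X := by linarith
    _ = 2 * Real.log X ^ (10000 * (k : ℝ) ^ 10) *
        (X * Real.log X ^ (-(10000 * (k : ℝ) ^ 10))) := by
      rw [Real.rpow_neg hl0.le]
      field_simp
    _ ≤ C * (X * Real.log X ^ (-(10000 * (k : ℝ) ^ 10))) := by gcongr
    _ ≤ _ := by gcongr; linarith

open Filter Topology in
/-- Diagonalization: a property monotone in `η` that holds eventually for every `η > 0` holds
eventually along some `δ → 0`. -/
lemma exists_tendsto_zero_of_eventually {P : ℝ → ℝ → Prop}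
    (hmono : ∀ X η η', 3 ≤ X → η ≤ η' → P η X → P η' X)
    (hev : ∀ η, 0 < η → ∀ᶠ X in atTop, P η X) :
    ∃ δ : ℝ → ℝ, Tendsto δ atTop (𝓝 0) ∧ ∀ᶠ X in atTop, P (δ X) X := by
  have hbdd : ∀ X, BddBelow {η | 0 < η ∧ P η X} := fun X => ⟨0, fun η hη => hη.1.le⟩
  have hnn : ∀ X, 0 ≤ sInf {η | 0 < η ∧ P η X} := fun X => Real.sInf_nonneg fun η hη => hη.1.le
  -- the infimum need not be attained; adding `X⁻¹` makes room for an admissible `η` below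
  refine ⟨fun X => sInf {η | 0 < η ∧ P η X} + X⁻¹, ?_, ?_⟩
  · rw [Metric.tendsto_atTop']
    intro e he
    have h1 : ∀ᶠ X : ℝ in atTop, X⁻¹ < e / 2 :=
      tendsto_inv_atTop_zero.eventually (gt_mem_nhds (by positivity))
    obtain ⟨N, hN⟩ := eventually_atTop.1
      ((hev (e / 2) (by positivity)).and (h1.and (eventually_gt_atTop 0)))
    refine ⟨N, fun X hX => ?_⟩
    obtain ⟨h2, h3, h4⟩ := hN X hX.le
    have h5 : sInf {η | 0 < η ∧ P η X} ≤ e / 2 := csInf_le (hbdd X) ⟨by positivity, h2⟩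
    rw [Real.dist_eq, sub_zero, abs_of_nonneg (add_nonneg (hnn X) (inv_nonneg.2 h4.le))]
    linarith
  · filter_upwards [hev 1 one_pos, eventually_ge_atTop 3] with X h1 h3
    have hne : {η | 0 < η ∧ P η X}.Nonempty := ⟨1, one_pos, h1⟩
    have hX : 0 < X⁻¹ := inv_pos.2 (by linarith)
    obtain ⟨η, ⟨-, hη⟩, hlt⟩ := exists_lt_of_csInf_lt hne
      (lt_add_of_pos_right (sInf {η | 0 < η ∧ P η X}) hX)
    exact hmono X η _ h3 hlt.le hη

theorem mainTheorem2 (k : ℕ) (hk : 1 ≤ k) :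
    ∃ (C : ℝ) (δ : ℝ → ℝ), 0 < C ∧ Filter.Tendsto δ Filter.atTop (nhds 0) ∧
      ∀ (ε' X H₁ : ℝ) (q : ℕ) (a : ℤ), 0 < ε' → 3 ≤ X → H₁ ≤ X →
        (Real.log X) ^ ((1 + 2 * ε') * k * Real.log k) ≤ H₁ →
        1 ≤ q →
        (q : ℝ) ≤ min (H₁ / (Real.log X) ^ ((1 + 2 * ε') * k * Real.log k))
          ((Real.log X) ^ (10000 * (k : ℝ) ^ 10)) →
        IsCoprime a (q : ℤ) →
        ∃ E : Set ℝ, MeasurableSet E ∧ E ⊆ Set.Icc (X / 2) (2 * X) ∧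
          MeasureTheory.volume E ≤ ENNReal.ofReal
            (C * (X * (Real.log X) ^ (-(10000 * (k : ℝ) ^ 10)) +
              X * ((Real.log X) ^ (3 * (1 + ε') * k * Real.log k + 7) / (H₁ / q) ^ 2))) ∧
          ∀ x ∈ Set.Icc (X / 2) (2 * X) \ E,
            dTildeSum k ε' X x H₁ a q ≤
              C * (H₁ / q) * (Real.log X) ^ ((k : ℝ) - 1 + δ X) := by
  obtain ⟨δ, hδ, hev⟩ := exists_tendsto_zero_of_eventually (P := MajorantBound k 4)
    (fun X η η' hX hη h => h.mono hX (by norm_num) le_rfl hη)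
    (fun η hη => eventually_majorantBound hk hη)
  obtain ⟨X₀, hX₀⟩ := Filter.eventually_atTop.1 hev
  refine ⟨max 4 (2 * Real.log X₀ ^ (10000 * (k : ℝ) ^ 10)), δ, by positivity, hδ, ?_⟩
  intro ε' X H₁ q a hε hX hH hlow hq hqle haq
  have hmain : MajorantBound k (max 4 (2 * Real.log X₀ ^ (10000 * (k : ℝ) ^ 10))) (δ X) X := by
    rcases le_total X₀ X with h | h
    · exact (hX₀ X h).mono hX (by norm_num) (le_max_left _ _) le_rfl
    · refine majorantBound_of_large_constant hX (le_trans ?_ (le_max_right _ _))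
      have hl0 : 0 ≤ Real.log X := Real.log_nonneg (by linarith)
      gcongr
  exact hmain ε' H₁ q a hε hH hlow hq hqle haq
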